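/- Let $\Lambda=(\Lambda_{kl})_{1\le k,l\le 4}$ be a real symmetric nonnegative-definite $4\times 4$ matrix with $\Lambda_{kk}=1$ for all $k$. Let $F(\Lambda)=E[\max(X_1,X_2,X_3,X_4)]$, where $(X_1,X_2,X_3,X_4)$ is a centered Gaussian random vector with covariance matrix $\Lambda$. For $k<l$ put $\Lambda'_{kl}=1-\Lambda_{kl}$ and $$\tilde\Lambda_{kl}=(1-\Lambda_{kl}+\Lambda_{kb}-\Lambda_{lb})(1-\Lambda_{kl}+\Lambda_{ka}-\Lambda_{la})-2(1-\Lambda_{kl})(1-\Lambda_{la}-\Lambda_{lb}+\Lambda_{ab}),$$ where $a<b$ are the two elements of $\{1,2,3,4\}\setminus\{k,l\}$. Let $\tilde A=6\sqrt2\,V$, where $V=\frac16\sqrt{\det\Sigma}$ is the volume of the tetrahedron with vertices $X_1,X_2,X_3,X_4$ in $L^2$ and $$\Sigma=\begin{pmatrix}2(1-\Lambda_{12})&1-\Lambda_{12}+\Lambda_{13}-\Lambda_{23}&1-\Lambda_{12}+\Lambda_{14}-\Lambda_{24}\\1-\Lambda_{12}+\Lambda_{13}-\Lambda_{23}&2(1-\Lambda_{23})&1-\Lambda_{23}-\Lambda_{24}+\Lambda_{34}\\1-\Lambda_{12}+\Lambda_{14}-\Lambda_{24}&1-\Lambda_{23}-\Lambda_{24}+\Lambda_{34}&2(1-\Lambda_{24})\end{pmatrix}$$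 is the covariance matrix of $(X_1-X_2,X_3-X_2,X_4-X_2)$. (i) One has $\Lambda'_{kl}\tilde A^2+\tilde\Lambda_{kl}^2>0$ for all $k<l$ if and only if $\Lambda_{kl}\ne1$ for all $k<l$, and in that case $$F(\Lambda)=\frac{1}{2\sqrt{\pi^3}}\sum_{1\le k<l\le4}\sqrt{\Lambda'_{kl}}\,\arccos\left(\frac{\tilde\Lambda_{kl}}{\sqrt{\Lambda'_{kl}\tilde A^2+\tilde\Lambda_{kl}^2}}\right).$$ (ii) If $\Lambda_{14}=1$, then $$F(\Lambda)=\frac{1}{2\sqrt\pi}\left(\sqrt{\Lambda'_{12}}+\sqrt{\Lambda'_{13}}+\sqrt{\Lambda'_{23}}\right).$$ -/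

import Mathlib

open MeasureTheory ProbabilityTheory

noncomputable section

namespace GaussMax

/-- The `4 × 4` real matrices; the indices `1, 2, 3, 4` of the mathematics are `0, 1, 2, 3` here. -/
abbrev Mat := Matrix (Fin 4) (Fin 4) ℝ

/-- Membership of `X = (X 0, …, X 3)` in the class of centered (jointly) Gaussian random vectors
with `E[X i ^ 2] = 1` for every `i`. -/
structure IsStdGaussianVector {Ω : Type*} [MeasurableSpace Ω] (P : Measure Ω)
    (X : Fin 4 → Ω → ℝ) : Prop where
  gaussian : HasGaussianLaw (fun ω ↦ (X · ω)) P
  centered : ∀ i, ∫ ω, X i ω ∂P = 0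
  second_moment : ∀ i, ∫ ω, X i ω ^ 2 ∂P = 1

/-- The covariance matrix of a random vector. -/
def covMatrix {Ω : Type*} [MeasurableSpace Ω] (P : Measure Ω) (X : Fin 4 → Ω → ℝ) : Mat :=
  Matrix.of fun i j ↦ cov[X i, X j; P]

/-- `E[max (X₁, X₂, X₃, X₄)]`. -/
def expMax {Ω : Type*} [MeasurableSpace Ω] (P : Measure Ω) (X : Fin 4 → Ω → ℝ) : ℝ :=
  ∫ ω, max (max (X 0 ω) (X 1 ω)) (max (X 2 ω) (X 3 ω)) ∂P

/-- The nonnegative-definite symmetric matrices with all diagonal entries equal to `1`. -/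
def SBar : Set Mat := {Λ | Λ.PosSemidef ∧ ∀ i, Λ i i = 1}

/-- `F(Λ) = E[max (X₁, X₂, X₃, X₄)]`, where `X` is the centered Gaussian vector with covariance
matrix `Λ` given by the coordinates on `ℝ⁴` under the law `N(0, Λ)`.  By `expMax_eq_F` below, any
other centered Gaussian vector with covariance matrix `Λ` gives the same value. -/
def F (Λ : Mat) : ℝ :=
  expMax (multivariateGaussian (0 : EuclideanSpace ℝ (Fin 4)) Λ) fun i x ↦ x i

/-- `Λ'_{kl} = 1 - Λ_{kl}`. -/
def prime (Λ : Mat) (k l : Fin 4) : ℝ := 1 - Λ k l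

/-- The covariance matrix of `(X₁ - X₂, X₃ - X₂, X₄ - X₂)`. -/
def edgeCov (Λ : Mat) : Matrix (Fin 3) (Fin 3) ℝ :=
  !![2 * (1 - Λ 0 1), 1 - Λ 0 1 + Λ 0 2 - Λ 1 2, 1 - Λ 0 1 + Λ 0 3 - Λ 1 3;
     1 - Λ 0 1 + Λ 0 2 - Λ 1 2, 2 * (1 - Λ 1 2), 1 - Λ 1 2 - Λ 1 3 + Λ 2 3;
     1 - Λ 0 1 + Λ 0 3 - Λ 1 3, 1 - Λ 1 2 - Λ 1 3 + Λ 2 3, 2 * (1 - Λ 1 3)]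

/-- The volume of the tetrahedron in `L²` with vertices `X₁, X₂, X₃, X₄`: one sixth of the square
root of the Gram determinant of the edges at the vertex `X₂`. -/
def tetraVolume (Λ : Mat) : ℝ := Real.sqrt (edgeCov Λ).det / 6

/-- `Ã = 6 √2 V`, with `V` the volume of the tetrahedron. -/
def tildeA (Λ : Mat) : ℝ := 6 * Real.sqrt 2 * tetraVolume Λ

lemma compl_pair_nonempty (k l : Fin 4) : (({k, l} : Finset (Fin 4))ᶜ).Nonempty := by
  revert k l; decide

/-- The polynomial expression defining `Λ̃_{12}`, with `1, 2, 3, 4` replaced by `k, l, a, b`. -/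
def tildeAux (Λ : Mat) (k l a b : Fin 4) : ℝ :=
  (1 - Λ k l + Λ k b - Λ l b) * (1 - Λ k l + Λ k a - Λ l a)
    - 2 * (1 - Λ k l) * (1 - Λ l a - Λ l b + Λ a b)

/-- `Λ̃_{kl}`: the other two indices are taken in increasing order. -/
def tilde (Λ : Mat) (k l : Fin 4) : ℝ :=
  tildeAux Λ k l (({k, l} : Finset (Fin 4))ᶜ.min' (compl_pair_nonempty k l))
    (({k, l} : Finset (Fin 4))ᶜ.max' (compl_pair_nonempty k l))

/-- `Λ'_{kl} Ã² + Λ̃_{kl}²`. -/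
def radicand (Λ : Mat) (k l : Fin 4) : ℝ := prime Λ k l * tildeA Λ ^ 2 + tilde Λ k l ^ 2

/-- The matrices in `SBar` for which `Λ'_{kl} Ã² + Λ̃_{kl}² > 0` for all `k < l`. -/
def S₁ : Set Mat := {Λ | Λ ∈ SBar ∧ ∀ k l, k < l → 0 < radicand Λ k l}

/-- The matrices in `SBar` with no off-diagonal entry equal to `1`. -/
def S₂ : Set Mat := {Λ | Λ ∈ SBar ∧ ∀ k l, k < l → Λ k l ≠ 1}

/-- The pairs `(k, l)` with `k < l`. -/
def pairs : Finset (Fin 4 × Fin 4) := Finset.univ.filter fun p ↦ p.1 < p.2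

/-! ### `F` is well defined -/

lemma integrable_max {Ω : Type*} [MeasurableSpace Ω] {P : Measure Ω} {X : Fin 4 → Ω → ℝ}
    (hX : HasGaussianLaw (fun ω ↦ (X · ω)) P) :
    Integrable (fun ω ↦ max (max (X 0 ω) (X 1 ω)) (max (X 2 ω) (X 3 ω))) P := by
  have h : ∀ i, Integrable (X i) P := fun i ↦ hX.integrable.eval i
  exact ((h 0).sup (h 1)).sup ((h 2).sup (h 3))

/-- The vector used in the definition of `F` is of the required kind. -/
lemma isStdGaussianVector_coord {Λ : Mat} (hΛ : Λ ∈ SBar) :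
    IsStdGaussianVector (multivariateGaussian (0 : EuclideanSpace ℝ (Fin 4)) Λ)
      (fun i x ↦ x i) ∧
    covMatrix (multivariateGaussian (0 : EuclideanSpace ℝ (Fin 4)) Λ) (fun i x ↦ x i) = Λ := by
  have hc : ∀ i : Fin 4,
      ∫ x : EuclideanSpace ℝ (Fin 4), x i ∂(multivariateGaussian 0 Λ) = 0 := by
    intro i
    have h := (EuclideanSpace.proj (𝕜 := ℝ) i).integral_comp_comm
      (IsGaussian.integrable_fun_id (μ := multivariateGaussian (0 : EuclideanSpace ℝ (Fin 4)) Λ))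
    simpa using h
  refine ⟨⟨?_, hc, fun i ↦ ?_⟩, ?_⟩
  · exact IsGaussian.hasGaussianLaw_id.map_equiv_fun
      (PiLp.continuousLinearEquiv 2 ℝ fun _ : Fin 4 ↦ ℝ)
  · have h := variance_eval_multivariateGaussian (μ := 0) hΛ.1 i
    rw [variance_of_integral_eq_zero (by fun_prop) (hc i), hΛ.2 i] at h
    simpa using h
  · ext i j
    exact covariance_eval_multivariateGaussian hΛ.1 i j

/-- `F(Λ)` is the expected maximum of any centered Gaussian vector with covariance matrix `Λ`. -/
lemma expMax_eq_F {Ω : Type*} [MeasurableSpace Ω] {P : Measure Ω} {X : Fin 4 → Ω → ℝ}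
    (hX : IsStdGaussianVector P X) {Λ : Mat} (hΛ : Λ ∈ SBar) (hcov : covMatrix P X = Λ) :
    expMax P X = F Λ := by
  have : IsProbabilityMeasure P := hX.gaussian.isProbabilityMeasure
  have hG := hX.gaussian.toLp_pi 2
  have hlaw : P.map (fun ω ↦ WithLp.toLp 2 (X · ω)) =
      multivariateGaussian (0 : EuclideanSpace ℝ (Fin 4)) Λ := by
    have := hG.isGaussian_map
    have hint : Integrable (fun ω ↦ WithLp.toLp 2 (X · ω)) P := hG.integrable
    have hL2 : ∀ i, MemLp (X i) 2 P := fun i ↦ hX.gaussian.memLp_two.eval i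
    apply IsGaussian.ext
    · rw [integral_id_multivariateGaussian', integral_map hG.aemeasurable (by fun_prop)]
      ext i
      have h := (EuclideanSpace.proj (𝕜 := ℝ) i).integral_comp_comm hint
      have h0 := hX.centered i
      exact h.symm.trans h0
    · rw [← ContinuousLinearMap.toBilinForm_inj]
      refine LinearMap.BilinForm.ext_basis (EuclideanSpace.basisFun (Fin 4) ℝ).toBasis
        fun i j ↦ ?_
      have hij : cov[X i, X j; P] = Λ i j := by rw [← hcov]; rfl
      simp only [ContinuousLinearMap.toBilinForm_apply, OrthonormalBasis.coe_toBasis]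
      rw [covarianceBilin_apply_basisFun hL2, covarianceBilin_multivariateGaussian hΛ.1, hij]
      simp
  unfold F expMax
  rw [← hlaw, integral_map hG.aemeasurable (by fun_prop)]

/-- `edgeCov Λ` is the covariance matrix of the three edges `X₁ - X₂, X₃ - X₂, X₄ - X₂`. -/
lemma edgeCov_eq {Ω : Type*} [MeasurableSpace Ω] {P : Measure Ω} {X : Fin 4 → Ω → ℝ}
    (hX : IsStdGaussianVector P X) {Λ : Mat} (hΛ : Λ ∈ SBar) (hcov : covMatrix P X = Λ)
    (i j : Fin 3) :
    cov[X (![0, 2, 3] i) - X 1, X (![0, 2, 3] j) - X 1; P] = edgeCov Λ i j := by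
  have : IsProbabilityMeasure P := hX.gaussian.isProbabilityMeasure
  have hL2 : ∀ i, MemLp (X i) 2 P := fun i ↦ hX.gaussian.memLp_two.eval i
  have hij : ∀ i j, cov[X i, X j; P] = Λ i j := fun i j ↦ by rw [← hcov]; rfl
  have hs : ∀ i j, Λ i j = Λ j i := fun i j ↦ by simpa using hΛ.1.1.apply j i
  have e : ∀ a b, cov[X a - X 1, X b - X 1; P] = Λ a b - Λ a 1 - (Λ 1 b - Λ 1 1) := by
    intro a b
    rw [covariance_sub_left (hL2 a) (hL2 1) ((hL2 b).sub (hL2 1)),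
      covariance_sub_right (hL2 a) (hL2 b) (hL2 1), covariance_sub_right (hL2 1) (hL2 b) (hL2 1)]
    simp only [hij]
  rw [e]
  have h1 := hs 1 0
  have h2 := hs 2 0
  have h3 := hs 3 0
  have h4 := hs 2 1
  have h5 := hs 3 1
  have h6 := hs 3 2
  fin_cases i <;> fin_cases j <;> simp [edgeCov, hΛ.2] <;> linarith

end GaussMax

end

open MeasureTheory ProbabilityTheory

noncomputable section

namespace GaussMax

open Set Filter Topology Matrix
open scoped MatrixOrder

/-! Suppose first that `Λ` is positive definite. Ties have probability zero and `X 0` has mean zero,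
so `F Λ` is the sum over `k = 1, 2, 3` of `E[X k - X 0; X k is the largest]`. Each term is the mean
of one coordinate of the Gaussian vector `Y = (X k - X i)`, `i ≠ k`, over the positive octant
(`expMax_eq_sum_octants`).

If `S` is the covariance matrix of `Y`, then `y 0 = ∑ m, S 0 m * (S⁻¹ y) m`, and `(S⁻¹ y) m *
exp(-y·S⁻¹y/2)` is minus a partial derivative. Integration by parts leaves Gaussian integrals over
the faces `y m = 0` of the octant. In the plane such an integral is an angle, here the exterior
dihedral angle of the tetrahedron at an edge (`integral_octant_coord`). An edge avoiding `X 0`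
receives one term from each endpoint, and the two coefficients add up to the variance `2Λ'` of the
edge; an edge through `X 0` receives a single term with that full coefficient.

A singular `Λ` is reached as a limit of `(1 - t)Λ + t·1`: `F` converges by dominated convergence,
and the formula is continuous where no radicand vanishes. Each radicand is the product of the Gram
determinants of the two faces at the edge (`radicand_eq`), which gives the equivalence in (i).

For (ii), `X` and `-X` have the same law, so `2F` is the mean range of the variables; the range of
three reals is half the sum of their pairwise distances. -/

/-! ### Planar Gaussian integrals over a quadrant. -/

lemma integral_Ioi_mul_exp_neg_sq {c : ℝ} (hc : 0 < c) :
    IntegrableOn (fun y : ℝ ↦ y * Real.exp (-(c * y ^ 2) / 2)) (Ioi 0) ∧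
      ∫ y in Ioi (0 : ℝ), y * Real.exp (-(c * y ^ 2) / 2) = 1 / c := by
  have hd : ∀ y : ℝ, HasDerivAt (fun y : ℝ ↦ -(Real.exp (-(c * y ^ 2) / 2) / c))
      (y * Real.exp (-(c * y ^ 2) / 2)) y := by
    intro y
    have h := (((((hasDerivAt_pow 2 y).const_mul c).neg.div_const 2).exp).div_const c).neg
    refine h.congr_deriv ?_
    field_simp
    simp
    rw [neg_div]
    ring
  have hlim : Tendsto (fun y : ℝ ↦ -(Real.exp (-(c * y ^ 2) / 2) / c)) atTop (𝓝 0) := by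
    have h1 : Tendsto (fun y : ℝ ↦ -(c * y ^ 2) / 2) atTop atBot := by
      have : Tendsto (fun y : ℝ ↦ (c / 2) * y ^ 2) atTop atTop :=
        (tendsto_pow_atTop (by norm_num)).const_mul_atTop (by positivity)
      refine (tendsto_neg_atTop_atBot.comp this).congr fun y ↦ ?_
      simp only [Function.comp]
      ring
    simpa using ((Real.tendsto_exp_atBot.comp h1).div_const c).neg
  have hpos : ∀ y ∈ Ioi (0 : ℝ), 0 ≤ y * Real.exp (-(c * y ^ 2) / 2) := fun y hy ↦
    mul_nonneg (le_of_lt hy) (Real.exp_pos _).le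
  refine ⟨integrableOn_Ioi_deriv_of_nonneg' (fun y _ ↦ hd y) hpos hlim, ?_⟩
  rw [integral_Ioi_of_hasDerivAt_of_nonneg' (fun y _ ↦ hd y) hpos hlim]
  simp

lemma quadratic_pos {a b c : ℝ} (ha : 0 < a) (hD : 0 < a * c - b ^ 2) (s : ℝ) :
    0 < a * s ^ 2 + 2 * b * s + c := by
  have : 0 < a * (a * s ^ 2 + 2 * b * s + c) := by
    nlinarith [sq_nonneg (a * s + b)]
  exact (mul_pos_iff_of_pos_left ha).1 this

/-- An antiderivative is `arctan((a s + b)/r)/r` with `r² = ac - b²`. The limit at infinity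
contributes `π/2`, and `π/2 - arctan(b/r) = arccos(b/√(ac))` because `r² + b² = ac`. -/
lemma integral_Ioi_inv_quadratic {a b c : ℝ} (ha : 0 < a) (hD : 0 < a * c - b ^ 2) :
    IntegrableOn (fun s : ℝ ↦ 1 / (a * s ^ 2 + 2 * b * s + c)) (Ioi 0) ∧
      ∫ s in Ioi (0 : ℝ), 1 / (a * s ^ 2 + 2 * b * s + c) =
        Real.arccos (b / √(a * c)) / √(a * c - b ^ 2) := by
  set r := √(a * c - b ^ 2) with hr
  have hr0 : 0 < r := Real.sqrt_pos.2 hD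
  have hr2 : r ^ 2 = a * c - b ^ 2 := Real.sq_sqrt hD.le
  have hd : ∀ s : ℝ, HasDerivAt (fun s : ℝ ↦ Real.arctan ((a * s + b) / r) / r)
      (1 / (a * s ^ 2 + 2 * b * s + c)) s := by
    intro s
    have h := (((((hasDerivAt_id s).const_mul a).add_const b).div_const r).arctan).div_const r
    refine h.congr_deriv ?_
    have hq := quadratic_pos ha hD s
    have h1 : 1 + ((a * id s + b) / r) ^ 2 = a * (a * s ^ 2 + 2 * b * s + c) / r ^ 2 := by
      rw [div_pow, eq_div_iff (by positivity), add_mul, div_mul_cancel₀ _ (by positivity), hr2]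
      simp only [id]
      ring
    rw [h1]
    field_simp
  have hlim : Tendsto (fun s : ℝ ↦ Real.arctan ((a * s + b) / r) / r) atTop
      (𝓝 (Real.pi / 2 / r)) := by
    refine Tendsto.div_const ?_ r
    refine (Real.tendsto_arctan_atTop.mono_right nhdsWithin_le_nhds).comp ?_
    exact (tendsto_atTop_add_const_right _ b (tendsto_id.const_mul_atTop ha)).atTop_div_const hr0
  have hpos : ∀ s ∈ Ioi (0 : ℝ), 0 ≤ 1 / (a * s ^ 2 + 2 * b * s + c) := fun s _ ↦
    (one_div_pos.2 (quadratic_pos ha hD s)).le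
  refine ⟨integrableOn_Ioi_deriv_of_nonneg' (fun y _ ↦ hd y) hpos hlim, ?_⟩
  rw [integral_Ioi_of_hasDerivAt_of_nonneg' (fun y _ ↦ hd y) hpos hlim, ← sub_div,
    Real.arccos_eq_pi_div_two_sub_arcsin, Real.arctan_eq_arcsin]
  congr 3
  have h1 : 1 + ((a * 0 + b) / r) ^ 2 = (a * c) / r ^ 2 := by
    rw [div_pow, eq_div_iff (by positivity), add_mul, div_mul_cancel₀ _ (by positivity), hr2]
    ring
  rw [h1, Real.sqrt_div' _ (by positivity), Real.sqrt_sq hr0.le]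
  simp only [mul_zero, zero_add]
  rw [div_div_div_cancel_right₀ hr0.ne']

/-- The integral of a centred Gaussian density over a quadrant is an angle. -/
lemma integral_quadrant_exp_quadratic {a b c : ℝ} (ha : 0 < a) (hD : 0 < a * c - b ^ 2) :
    ∫ y in Ioi (0 : ℝ), ∫ x in Ioi (0 : ℝ),
        Real.exp (-(a * x ^ 2 + 2 * b * x * y + c * y ^ 2) / 2) =
      Real.arccos (b / √(a * c)) / √(a * c - b ^ 2) := by
  -- The substitution `x = s y` at fixed `y` makes the exponent a multiple of `y²`; after exchanging
  -- the integrals, the one in `y` is elementary.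
  have h1 : ∀ y ∈ Ioi (0 : ℝ), ∫ x in Ioi (0 : ℝ),
      Real.exp (-(a * x ^ 2 + 2 * b * x * y + c * y ^ 2) / 2) =
      ∫ s in Ioi (0 : ℝ), y * Real.exp (-((a * s ^ 2 + 2 * b * s + c) * y ^ 2) / 2) := by
    intro y hy
    have := integral_comp_mul_left_Ioi'
      (fun x ↦ Real.exp (-(a * x ^ 2 + 2 * b * x * y + c * y ^ 2) / 2)) 0 (mem_Ioi.1 hy)
    rw [mul_zero] at this
    rw [← this, smul_eq_mul, ← integral_const_mul]
    congr with s
    congr 2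
    ring
  rw [setIntegral_congr_fun measurableSet_Ioi h1]
  have hint : Integrable (Function.uncurry fun s y : ℝ ↦
      y * Real.exp (-((a * s ^ 2 + 2 * b * s + c) * y ^ 2) / 2))
      ((volume.restrict (Ioi 0)).prod (volume.restrict (Ioi 0))) := by
    rw [integrable_prod_iff (Continuous.aestronglyMeasurable (by fun_prop))]
    refine ⟨ae_of_all _ fun s ↦ (integral_Ioi_mul_exp_neg_sq (quadratic_pos ha hD s)).1, ?_⟩
    refine (integral_Ioi_inv_quadratic ha hD).1.congr (ae_of_all _ fun s ↦ ?_)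
    simp only
    rw [← (integral_Ioi_mul_exp_neg_sq (quadratic_pos ha hD s)).2]
    refine setIntegral_congr_fun measurableSet_Ioi fun y hy ↦ ?_
    simp only [Function.uncurry]
    rw [Real.norm_of_nonneg (mul_nonneg (le_of_lt hy) (Real.exp_pos _).le)]
  rw [← integral_integral_swap hint, ← (integral_Ioi_inv_quadratic ha hD).2]
  refine setIntegral_congr_fun measurableSet_Ioi fun s _ ↦ ?_
  exact (integral_Ioi_mul_exp_neg_sq (quadratic_pos ha hD s)).2

/-! ### Densities of nondegenerate Gaussian vectors. -/

section Density
variable {ι : Type*} [Fintype ι]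

/-- The density of the standard Gaussian measure on `ι → ℝ`. -/
lemma pi_gaussianReal_eq_withDensity :
    Measure.pi (fun _ : ι ↦ gaussianReal 0 1) = (volume : Measure (ι → ℝ)).withDensity
      (fun x ↦ ENNReal.ofReal ((√(2 * Real.pi))⁻¹ ^ Fintype.card ι *
        Real.exp (-(x ⬝ᵥ x) / 2))) := by
  have hpdf : ∀ x : ι → ℝ, (√(2 * Real.pi))⁻¹ ^ Fintype.card ι * Real.exp (-(x ⬝ᵥ x) / 2) =
      ∏ i, gaussianPDFReal 0 1 (x i) := by
    intro x
    simp only [gaussianPDFReal, sub_zero, NNReal.coe_one, mul_one, Finset.prod_mul_distrib,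
      Finset.prod_const, Finset.card_univ, ← Real.exp_sum]
    congr 2
    rw [dotProduct, ← Finset.sum_neg_distrib, Finset.sum_div]
    exact Finset.sum_congr rfl fun i _ ↦ by ring
  simp_rw [hpdf]
  refine Measure.pi_eq fun s hs ↦ ?_
  rw [withDensity_apply _ (MeasurableSet.univ_pi hs), volume_pi, Measure.restrict_pi_pi,
    ← ofReal_integral_eq_lintegral_ofReal]
  · rw [integral_fintype_prod_eq_prod (f := fun _ ↦ gaussianPDFReal 0 1),
      ENNReal.ofReal_prod_of_nonneg]
    · exact Finset.prod_congr rfl fun i _ ↦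
        (gaussianReal_apply_eq_integral 0 one_ne_zero (s i)).symm
    · exact fun i _ ↦ integral_nonneg fun x ↦ gaussianPDFReal_nonneg 0 1 x
  · exact Integrable.fintype_prod (f := fun _ ↦ gaussianPDFReal 0 1)
      fun i ↦ (integrable_gaussianPDFReal 0 1).integrableOn
  · exact ae_of_all _ fun x ↦ Finset.prod_nonneg fun i _ ↦ gaussianPDFReal_nonneg 0 1 _

variable [DecidableEq ι]

/-- The density of a nondegenerate centred Gaussian vector with covariance matrix `S`. -/
def gaussianDensity (S : Matrix ι ι ℝ) (y : ι → ℝ) : ℝ :=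
  (√(2 * Real.pi))⁻¹ ^ Fintype.card ι * (√S.det)⁻¹ * Real.exp (-(y ⬝ᵥ S⁻¹ *ᵥ y) / 2)

lemma gaussianDensity_nonneg (S : Matrix ι ι ℝ) (y : ι → ℝ) : 0 ≤ gaussianDensity S y := by
  unfold gaussianDensity
  positivity

lemma continuous_gaussianDensity (S : Matrix ι ι ℝ) : Continuous (gaussianDensity S) := by
  unfold gaussianDensity
  fun_prop

/-- The law is the image of the standard Gaussian under `M = √S`. Since `M` is symmetric, `S⁻¹`
pulls back along `M` to the standard inner product, and the Jacobian is `|det M| = √(det S)`. -/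
lemma map_multivariateGaussian_eq_withDensity {S : Matrix ι ι ℝ} (hS : S.PosDef) :
    (multivariateGaussian (0 : EuclideanSpace ℝ ι) S).map WithLp.ofLp =
      (volume : Measure (ι → ℝ)).withDensity fun y ↦ ENNReal.ofReal (gaussianDensity S y) := by
  set M := CFC.sqrt S with hM
  have hMM : M * M = S := CFC.sqrt_mul_sqrt_self _ hS.posSemidef.nonneg
  have hMT : Mᵀ = M := by
    have := (CFC.sqrt_nonneg S).isSelfAdjoint
    rwa [IsSelfAdjoint, star_eq_conjTranspose, conjTranspose_eq_transpose_of_trivial] at this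
  have hdet : M.det * M.det = S.det := by rw [← det_mul, hMM]
  have hdet0 : M.det ≠ 0 := fun h ↦ by
    have := hS.det_pos
    rw [← hdet, h] at this
    simp at this
  have habs : √S.det = |M.det| := by rw [← hdet, Real.sqrt_mul_self_eq_abs]
  have hquad : ∀ x, (M *ᵥ x) ⬝ᵥ S⁻¹ *ᵥ (M *ᵥ x) = x ⬝ᵥ x := by
    intro x
    have hu : IsUnit M.det := hdet0.isUnit
    rw [← hMM, Matrix.mul_inv_rev, mulVec_mulVec, Matrix.mul_assoc, nonsing_inv_mul _ hu, Matrix.mul_one,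
      dotProduct_mulVec, ← mulVec_transpose, transpose_nonsing_inv, hMT, mulVec_mulVec,
      nonsing_inv_mul _ hu, one_mulVec]
  have hmap : (multivariateGaussian (0 : EuclideanSpace ℝ ι) S).map WithLp.ofLp =
      (Measure.pi fun _ : ι ↦ gaussianReal 0 1).map (toLin' M) := by
    rw [multivariateGaussian, ← map_pi_eq_stdGaussian, Measure.map_map (by fun_prop) (by fun_prop),
      Measure.map_map (by fun_prop) (by fun_prop)]
    congr 1
    ext x i
    simp [hM]
  have hcont : Continuous (toLin' M) := LinearMap.continuous_on_pi _
  rw [hmap, pi_gaussianReal_eq_withDensity]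
  ext s hs
  have hmeas : Measurable fun y ↦ ENNReal.ofReal (gaussianDensity S y) :=
    (continuous_gaussianDensity S).measurable.ennreal_ofReal
  rw [Measure.map_apply hcont.measurable hs, withDensity_apply _ (hcont.measurable hs),
    withDensity_apply _ hs]
  -- Used on the right-hand side only, so that the integral of the density is pulled back along `M`.
  have h1 : (volume : Measure (ι → ℝ)) =
      ENNReal.ofReal |M.det| • Measure.map (toLin' M) volume := by
    rw [Real.map_matrix_volume_pi_eq_smul_volume_pi hdet0, smul_smul,
      ← ENNReal.ofReal_mul (abs_nonneg _), ← abs_mul, mul_inv_cancel₀ hdet0, abs_one,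
      ENNReal.ofReal_one, one_smul]
  conv_rhs => rw [h1]
  rw [Measure.restrict_smul, lintegral_smul_measure, setLIntegral_map hs hmeas hcont.measurable,
    smul_eq_mul]
  erw [← lintegral_const_mul _ (hmeas.comp hcont.measurable)]
  refine lintegral_congr fun x ↦ ?_
  rw [Function.comp_apply, ← ENNReal.ofReal_mul (abs_nonneg _), gaussianDensity, toLin'_apply, hquad, habs]
  congr 1
  have : |M.det| ≠ 0 := abs_ne_zero.2 hdet0
  field_simp

end Density

/-- A Gaussian law is determined by its mean and covariance, so the density of the model vector
serves for `Y`. -/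
lemma map_eq_withDensity_gaussianDensity {ι Ω : Type*} [Fintype ι] [DecidableEq ι]
    [MeasurableSpace Ω] {P : Measure Ω} {Y : ι → Ω → ℝ} {S : Matrix ι ι ℝ} (hS : S.PosDef)
    (hY : HasGaussianLaw (fun ω ↦ (Y · ω)) P) (h0 : ∀ i, ∫ ω, Y i ω ∂P = 0)
    (hcov : ∀ i j, cov[Y i, Y j; P] = S i j) :
    P.map (fun ω ↦ (Y · ω)) =
      (volume : Measure (ι → ℝ)).withDensity fun y ↦ ENNReal.ofReal (gaussianDensity S y) := by
  have : IsProbabilityMeasure P := hY.isProbabilityMeasure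
  have hG := hY.toLp_pi 2
  have hlaw : P.map (fun ω ↦ WithLp.toLp 2 (Y · ω)) =
      multivariateGaussian (0 : EuclideanSpace ℝ ι) S := by
    have := hG.isGaussian_map
    have hint : Integrable (fun ω ↦ WithLp.toLp 2 (Y · ω)) P := hG.integrable
    have hL2 : ∀ i, MemLp (Y i) 2 P := fun i ↦ hY.memLp_two.eval i
    apply IsGaussian.ext
    · rw [integral_id_multivariateGaussian', integral_map hG.aemeasurable (by fun_prop)]
      ext i
      have h := (EuclideanSpace.proj (𝕜 := ℝ) i).integral_comp_comm hint
      exact h.symm.trans (h0 i)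
    · rw [← ContinuousLinearMap.toBilinForm_inj]
      refine LinearMap.BilinForm.ext_basis (EuclideanSpace.basisFun ι ℝ).toBasis
        fun i j ↦ ?_
      simp only [ContinuousLinearMap.toBilinForm_apply, OrthonormalBasis.coe_toBasis]
      rw [covarianceBilin_apply_basisFun hL2, covarianceBilin_multivariateGaussian hS.posSemidef,
        hcov]
      simp
  rw [← map_multivariateGaussian_eq_withDensity hS, ← hlaw,
    AEMeasurable.map_map_of_aemeasurable (by fun_prop) hG.aemeasurable]
  rfl

/-! ### Integration by parts over the octant. -/

/-- The integrand is the derivative of `-exp(-(a t² + 2 l t + q)/2)`. It may change sign when `l <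
0`, so integrability is assumed; Fubini supplies it for almost every slice. -/
lemma integral_Ioi_affine_mul_exp_quadratic {a : ℝ} (ha : 0 < a) (l q : ℝ)
    (hint : IntegrableOn (fun t : ℝ ↦ (a * t + l) * Real.exp (-(a * t ^ 2 + 2 * l * t + q) / 2))
      (Ioi 0)) :
    ∫ t in Ioi (0 : ℝ), (a * t + l) * Real.exp (-(a * t ^ 2 + 2 * l * t + q) / 2) =
      Real.exp (-q / 2) := by
  have hd : ∀ t : ℝ, HasDerivAt (fun t : ℝ ↦ -Real.exp (-(a * t ^ 2 + 2 * l * t + q) / 2))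
      ((a * t + l) * Real.exp (-(a * t ^ 2 + 2 * l * t + q) / 2)) t := by
    intro t
    have h := ((((((hasDerivAt_pow 2 t).const_mul a).add
      ((hasDerivAt_id t).const_mul (2 * l))).add_const q).neg.div_const 2).exp).neg
    refine (h.congr_deriv ?_)
    simp only [id, Pi.neg_apply, Pi.add_apply]
    push_cast
    ring
  have hlim : Tendsto (fun t : ℝ ↦ -Real.exp (-(a * t ^ 2 + 2 * l * t + q) / 2)) atTop (𝓝 0) := by
    have h1 : Tendsto (fun t : ℝ ↦ t * (a / 2 * t + l) + q / 2) atTop atTop :=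
      tendsto_atTop_add_const_right _ _ (tendsto_id.atTop_mul_atTop₀
        (tendsto_atTop_add_const_right _ _ (tendsto_id.const_mul_atTop (by positivity))))
    have h2 := (Real.tendsto_exp_atBot.comp (tendsto_neg_atTop_atBot.comp h1)).neg
    rw [neg_zero] at h2
    refine h2.congr fun t ↦ ?_
    simp only [Function.comp]
    congr 2
    ring
  rw [integral_Ioi_of_hasDerivAt_of_tendsto' (fun t _ ↦ hd t) hint hlim]
  simp

/-- Gaussian integration by parts in the coordinate `m`, over the positive octant. -/
lemma integral_octant_mulVec_mul_exp {Q : Matrix (Fin 3) (Fin 3) ℝ} (hQ : Q.IsSymm) (m : Fin 3)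
    (hm : 0 < Q m m)
    (hint : Integrable fun y : Fin 3 → ℝ ↦ (Q *ᵥ y) m * Real.exp (-(y ⬝ᵥ Q *ᵥ y) / 2)) :
    ∫ y in {y : Fin 3 → ℝ | ∀ i, 0 < y i}, (Q *ᵥ y) m * Real.exp (-(y ⬝ᵥ Q *ᵥ y) / 2) =
      ∫ y in Ioi (0 : ℝ), ∫ x in Ioi (0 : ℝ), Real.exp (-(Q (m.succAbove 0) (m.succAbove 0) * x ^ 2
        + 2 * Q (m.succAbove 0) (m.succAbove 1) * x * y
        + Q (m.succAbove 1) (m.succAbove 1) * y ^ 2) / 2) := by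
  set j := m.succAbove 0 with hj
  set k := m.succAbove 1 with hk
  have hs : ∀ a b, Q a b = Q b a := fun a b ↦ hQ.apply b a
  set e := MeasurableEquiv.piFinSuccAbove (fun _ : Fin 3 ↦ ℝ) m with he
  have hmp : MeasurePreserving e.symm :=
    (volume_preserving_piFinSuccAbove (fun _ : Fin 3 ↦ ℝ) m).symm e
  set f : (Fin 3 → ℝ) → ℝ := fun y ↦ (Q *ᵥ y) m * Real.exp (-(y ⬝ᵥ Q *ᵥ y) / 2) with hf
  set l : (Fin 2 → ℝ) → ℝ := fun z ↦ Q m j * z 0 + Q m k * z 1 with hl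
  set q : (Fin 2 → ℝ) → ℝ := fun z ↦
    Q j j * z 0 ^ 2 + 2 * Q j k * z 0 * z 1 + Q k k * z 1 ^ 2 with hq
  -- With the other two coordinates `z` frozen, the form is quadratic in `t = y m`, and `(Q y) m` is
  -- half its derivative in `t`.
  have hfe : ∀ p : ℝ × (Fin 2 → ℝ), f (e.symm p) =
      (Q m m * p.1 + l p.2) * Real.exp (-(Q m m * p.1 ^ 2 + 2 * l p.2 * p.1 + q p.2) / 2) := by
    intro p
    have hm0 : e.symm p m = p.1 := Fin.insertNth_apply_same (α := fun _ ↦ ℝ) m p.1 p.2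
    have hj0 : e.symm p j = p.2 0 := Fin.insertNth_apply_succAbove (α := fun _ ↦ ℝ) m p.1 p.2 0
    have hk0 : e.symm p k = p.2 1 := Fin.insertNth_apply_succAbove (α := fun _ ↦ ℝ) m p.1 p.2 1
    simp only [hf, dotProduct, mulVec, Fin.sum_univ_succAbove _ m, Fin.sum_univ_two,
      ← hj, ← hk, hm0, hj0, hk0, hl, hq]
    rw [hs j m, hs k m, hs k j]
    congr 2
    all_goals ring
  have hfint : Integrable (fun p ↦ f (e.symm p)) := by
    exact (hmp.integrable_comp_emb e.symm.measurableEmbedding).2 hint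
  have hpre : e.symm ⁻¹' {y : Fin 3 → ℝ | ∀ i, 0 < y i} =
      Ioi 0 ×ˢ {z : Fin 2 → ℝ | ∀ i, 0 < z i} := by
    ext p
    have h0 : ∀ i, e.symm p i = m.insertNth (α := fun _ ↦ ℝ) p.1 p.2 i := fun i ↦ rfl
    simp only [mem_preimage, mem_ofPred_eq, h0, m.forall_iff_succAbove, Fin.insertNth_apply_same,
      Fin.insertNth_apply_succAbove, mem_prod, mem_Ioi]
  have hfint' : Integrable (fun p ↦ f (e.symm p)) ((volume.restrict (Ioi 0)).prod
      (volume.restrict {z : Fin 2 → ℝ | ∀ i, 0 < z i})) := by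
    rw [Measure.prod_restrict]
    exact hfint.restrict
  have hinner : (fun z ↦ ∫ t in Ioi (0 : ℝ), f (e.symm (t, z))) =ᵐ[volume.restrict
      {z : Fin 2 → ℝ | ∀ i, 0 < z i}] fun z ↦ Real.exp (-q z / 2) := by
    filter_upwards [hfint'.prod_left_ae] with z hz
    simp only [hfe] at hz ⊢
    exact integral_Ioi_affine_mul_exp_quadratic hm _ _ hz
  -- Fubini also yields integrability of the Gaussian on the face, with no separate estimate.
  have hqint := hfint'.integral_prod_right.congr hinner
  rw [← hmp.setIntegral_preimage_emb e.symm.measurableEmbedding, hpre, Measure.volume_eq_prod,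
    ← Measure.prod_restrict, integral_prod_symm _ hfint', integral_congr_ae hinner]
  have hmp2 := (volume_preserving_piFinTwo fun _ : Fin 2 ↦ ℝ).symm
  have hpre2 : (MeasurableEquiv.piFinTwo fun _ : Fin 2 ↦ ℝ).symm ⁻¹'
      {z : Fin 2 → ℝ | ∀ i, 0 < z i} = Ioi 0 ×ˢ Ioi 0 := by
    ext p
    simp [MeasurableEquiv.piFinTwo, Fin.forall_fin_two]
  rw [← hmp2.setIntegral_preimage_emb (MeasurableEquiv.measurableEmbedding _), hpre2,
    Measure.volume_eq_prod, ← Measure.prod_restrict, integral_prod_symm]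
  · simp [MeasurableEquiv.piFinTwo, hq]
  · rw [Measure.prod_restrict, ← hpre2]
    exact (hmp2.restrict_preimage_emb (MeasurableEquiv.measurableEmbedding _) _).integrable_comp_emb
      (MeasurableEquiv.measurableEmbedding _) |>.2 hqint

/-- The exterior dihedral angle, at the edge `m`, of the tetrahedron spanned by three vectors with
Gram matrix `S`. -/
def exteriorAngle (S : Matrix (Fin 3) (Fin 3) ℝ) (m : Fin 3) : ℝ :=
  let j := m.succAbove 0
  let k := m.succAbove 1
  Real.arccos ((S m j * S m k - S m m * S j k) /
    √((S m m * S j j - S m j ^ 2) * (S m m * S k k - S m k ^ 2)))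

/-- The entries of `S⁻¹` away from the index `m` are cofactors over `det S`, and by Jacobi's
identity their `2 × 2` determinant is `S m m / det S`. The quadrant integral therefore has prefactor
`√(det S)/√(S m m)`, and `det S` cancels inside the `arccos`. -/
lemma integral_quadrant_exp_inv {S : Matrix (Fin 3) (Fin 3) ℝ} (hS : S.PosDef) (m : Fin 3) :
    ∫ y in Ioi (0 : ℝ), ∫ x in Ioi (0 : ℝ),
      Real.exp (-(S⁻¹ (m.succAbove 0) (m.succAbove 0) * x ^ 2
        + 2 * S⁻¹ (m.succAbove 0) (m.succAbove 1) * x * y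
        + S⁻¹ (m.succAbove 1) (m.succAbove 1) * y ^ 2) / 2) =
      √S.det / √(S m m) * exteriorAngle S m := by
  have hd := hS.det_pos
  have hmm : 0 < S m m := hS.diag_pos
  have hs : ∀ a b, S a b = S b a := fun a b ↦ by simpa using hS.isHermitian.apply b a
  have hjac : S⁻¹ (m.succAbove 0) (m.succAbove 0) =
        (S m m * S (m.succAbove 1) (m.succAbove 1) - S m (m.succAbove 1) ^ 2) / S.det ∧
      S⁻¹ (m.succAbove 1) (m.succAbove 1) =
        (S m m * S (m.succAbove 0) (m.succAbove 0) - S m (m.succAbove 0) ^ 2) / S.det ∧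
      S⁻¹ (m.succAbove 0) (m.succAbove 1) =
        (S m (m.succAbove 0) * S m (m.succAbove 1) -
          S m m * S (m.succAbove 0) (m.succAbove 1)) / S.det ∧
      (S m m * S (m.succAbove 1) (m.succAbove 1) - S m (m.succAbove 1) ^ 2) *
        (S m m * S (m.succAbove 0) (m.succAbove 0) - S m (m.succAbove 0) ^ 2) -
        (S m (m.succAbove 0) * S m (m.succAbove 1) -
          S m m * S (m.succAbove 0) (m.succAbove 1)) ^ 2 = S m m * S.det := by
    have e1 := hs 1 0
    have e2 := hs 2 0
    have e3 := hs 2 1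
    have h : S⁻¹ = S.det⁻¹ • S.adjugate := by
      rw [inv_def, Ring.inverse_eq_inv]
    rw [h, adjugate_fin_three, det_fin_three]
    fin_cases m <;> simp [Fin.succAbove, div_eq_inv_mul, Fin.lt_def] <;> rw [e1, e2, e3] <;>
      refine ⟨?_, ?_, ?_, ?_⟩ <;> first | ring1 | exact Or.inl (by ring)
  obtain ⟨h1, h2, h3, h4⟩ := hjac
  have ha : 0 < S⁻¹ (m.succAbove 0) (m.succAbove 0) := hS.inv.diag_pos
  have hD : S⁻¹ (m.succAbove 0) (m.succAbove 0) * S⁻¹ (m.succAbove 1) (m.succAbove 1) -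
      S⁻¹ (m.succAbove 0) (m.succAbove 1) ^ 2 = S m m / S.det := by
    rw [h1, h2, h3, div_pow, div_mul_div_comm, ← sq, ← sub_div, h4]
    field_simp
  rw [integral_quadrant_exp_quadratic ha (by rw [hD]; positivity), hD, exteriorAngle,
    Real.sqrt_div' _ hd.le, h1, h2, h3, div_mul_div_comm, ← sq S.det, Real.sqrt_div' _ (by positivity),
    Real.sqrt_sq hd.le, div_div_div_cancel_right₀ hd.ne', mul_comm
    (S m m * S (m.succAbove 1) (m.succAbove 1) - S m (m.succAbove 1) ^ 2)]
  field_simp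

/-- The mean of the first coordinate of a Gaussian vector in `ℝ³` over the positive octant. -/
lemma integral_octant_coord {Ω : Type*} [MeasurableSpace Ω] {P : Measure Ω}
    {Y : Fin 3 → Ω → ℝ} {S : Matrix (Fin 3) (Fin 3) ℝ} (hS : S.PosDef)
    (hY : HasGaussianLaw (fun ω ↦ (Y · ω)) P) (h0 : ∀ i, ∫ ω, Y i ω ∂P = 0)
    (hcov : ∀ i j, cov[Y i, Y j; P] = S i j) :
    ∫ ω, {y : Fin 3 → ℝ | ∀ i, 0 < y i}.indicator (fun y ↦ y 0) (Y · ω) ∂P =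
      (√(2 * Real.pi))⁻¹ ^ 3 * ∑ m, S 0 m / √(S m m) * exteriorAngle S m := by
  set O := {y : Fin 3 → ℝ | ∀ i, 0 < y i} with hO
  have hOm : MeasurableSet O := by
    have : O = ⋂ i, {y : Fin 3 → ℝ | 0 < y i} := by
      ext; simp [hO]
    rw [this]
    exact MeasurableSet.iInter fun i ↦ measurableSet_lt measurable_const (measurable_pi_apply i)
  have hlaw := map_eq_withDensity_gaussianDensity hS hY h0 hcov
  have hdm : Measurable fun y ↦ (gaussianDensity S y).toNNReal :=
    (continuous_gaussianDensity S).measurable.real_toNNReal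
  have hdens : ∀ y, ((gaussianDensity S y).toNNReal : ℝ) = gaussianDensity S y := fun y ↦
    Real.coe_toNNReal _ (gaussianDensity_nonneg S y)
  -- Integrability against the density is inherited from that of `Y i`.
  have hYint : ∀ i, Integrable (fun y : Fin 3 → ℝ ↦ gaussianDensity S y * y i) := by
    intro i
    have h1 : Integrable (fun y : Fin 3 → ℝ ↦ y i) (P.map fun ω ↦ (Y · ω)) := by
      rw [integrable_map_measure (measurable_pi_apply i).aestronglyMeasurable hY.aemeasurable]
      exact hY.integrable.eval i
    rw [hlaw] at h1
    have h2 := (integrable_withDensity_iff_integrable_smul hdm).1 h1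
    simpa only [NNReal.smul_def, hdens, smul_eq_mul] using h2
  set c := (√(2 * Real.pi))⁻¹ ^ 3 * (√S.det)⁻¹ with hc
  have hc0 : 0 < c := by
    have := hS.det_pos
    have := Real.pi_pos
    positivity
  have hgd : ∀ y, gaussianDensity S y = c * Real.exp (-(y ⬝ᵥ S⁻¹ *ᵥ y) / 2) := fun y ↦ by
    simp [gaussianDensity, hc]
  have hint : ∀ m, Integrable fun y : Fin 3 → ℝ ↦
      (S⁻¹ *ᵥ y) m * Real.exp (-(y ⬝ᵥ S⁻¹ *ᵥ y) / 2) := by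
    intro m
    have h := (integrable_finsetSum Finset.univ fun i _ ↦
      (hYint i).const_mul (S⁻¹ m i)).const_mul c⁻¹
    refine h.congr (ae_of_all _ fun y ↦ ?_)
    simp only [hgd, mulVec, dotProduct, Finset.mul_sum, Finset.sum_mul]
    refine Finset.sum_congr rfl fun i _ ↦ ?_
    field_simp
  -- Inserting `S S⁻¹ = 1` expresses the coordinate through the components of the gradient, which
  -- can be integrated by parts.
  have hcoord : ∀ y : Fin 3 → ℝ, y 0 = ∑ m, S 0 m * (S⁻¹ *ᵥ y) m := by
    intro y
    have : S *ᵥ (S⁻¹ *ᵥ y) = y := by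
      rw [mulVec_mulVec, mul_nonsing_inv _ hS.det_pos.ne'.isUnit, one_mulVec]
    exact (congrFun this 0).symm
  have hsymm : (S⁻¹).IsSymm := by
    have := hS.inv.isHermitian
    rwa [IsHermitian, conjTranspose_eq_transpose_of_trivial] at this
  have step : ∫ ω, O.indicator (fun y ↦ y 0) (Y · ω) ∂P =
      ∫ y in O, gaussianDensity S y * y 0 := by
    rw [← integral_map (f := O.indicator fun y ↦ y 0) hY.aemeasurable
      (((measurable_pi_apply 0).indicator hOm).aestronglyMeasurable), hlaw,
      integral_indicator hOm]
    have := setIntegral_withDensity_eq_setIntegral_smul (μ := (volume : Measure (Fin 3 → ℝ))) hdm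
      (fun y ↦ y 0) hOm
    simp only [NNReal.smul_def, hdens, smul_eq_mul] at this
    exact this
  rw [step]
  have : ∀ y : Fin 3 → ℝ, gaussianDensity S y * y 0 = ∑ m, c * S 0 m *
      ((S⁻¹ *ᵥ y) m * Real.exp (-(y ⬝ᵥ S⁻¹ *ᵥ y) / 2)) := by
    intro y
    rw [hgd, hcoord y, Finset.mul_sum]
    exact Finset.sum_congr rfl fun m _ ↦ by ring
  simp_rw [this]
  rw [integral_finsetSum _ fun m _ ↦ ((hint m).const_mul _).integrableOn, Finset.mul_sum]
  refine Finset.sum_congr rfl fun m _ ↦ ?_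
  rw [integral_const_mul, integral_octant_mulVec_mul_exp hsymm m hS.inv.diag_pos (hint m),
    integral_quadrant_exp_inv hS m, hc]
  have := Real.sqrt_pos.2 hS.det_pos
  field_simp

/-! ### Geometry of the tetrahedron. -/

/-- Four times the squared area of the triangle in `L²` with vertices `X i, X j, X k`. -/
def heron (Λ : Mat) (i j k : Fin 4) : ℝ :=
  2 * (prime Λ i j * prime Λ j k + prime Λ j k * prime Λ i k + prime Λ i j * prime Λ i k)
    - prime Λ i j ^ 2 - prime Λ j k ^ 2 - prime Λ i k ^ 2

/-- The exterior dihedral angle of the tetrahedron at the edge from `X k` to `X l`. -/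
def edgeAngle (Λ : Mat) (k l a b : Fin 4) : ℝ :=
  Real.arccos (tildeAux Λ k l a b / √(heron Λ k l a * heron Λ k l b))

lemma symm_of_mem {Λ : Mat} (hΛ : Λ ∈ SBar) (i j : Fin 4) : Λ i j = Λ j i := by
  simpa using hΛ.1.1.apply j i

/-- The edges `(k, l)` of the tetrahedron, each with its opposite edge `(a, b)`. -/
inductive IsEdge : Fin 4 → Fin 4 → Fin 4 → Fin 4 → Prop
  | e01 : IsEdge 0 1 2 3
  | e02 : IsEdge 0 2 1 3
  | e03 : IsEdge 0 3 1 2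
  | e12 : IsEdge 1 2 0 3
  | e13 : IsEdge 1 3 0 2
  | e23 : IsEdge 2 3 0 1

lemma exists_isEdge {k l : Fin 4} (h : k < l) : ∃ a b, IsEdge k l a b := by
  have : ∀ k l : Fin 4, k < l → (k = 0 ∧ l = 1) ∨ (k = 0 ∧ l = 2) ∨ (k = 0 ∧ l = 3) ∨
      (k = 1 ∧ l = 2) ∨ (k = 1 ∧ l = 3) ∨ (k = 2 ∧ l = 3) := by decide
  rcases this k l h with ⟨rfl, rfl⟩ | ⟨rfl, rfl⟩ | ⟨rfl, rfl⟩ | ⟨rfl, rfl⟩ | ⟨rfl, rfl⟩ | ⟨rfl, rfl⟩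
  exacts [⟨_, _, .e01⟩, ⟨_, _, .e02⟩, ⟨_, _, .e03⟩, ⟨_, _, .e12⟩, ⟨_, _, .e13⟩, ⟨_, _, .e23⟩]

lemma tilde_eq (Λ : Mat) {k l a b : Fin 4} (h : IsEdge k l a b) :
    tilde Λ k l = tildeAux Λ k l a b := by
  have h' : ({k, l} : Finset (Fin 4))ᶜ = {a, b} ∧ a ≤ b := by
    cases h <;> decide
  unfold tilde
  congr 1
  · simp only [h'.1]
    exact le_antisymm (Finset.min'_le _ _ (by simp)) (Finset.le_min' _ _ _ (by simp [h'.2]))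
  · simp only [h'.1]
    exact le_antisymm (Finset.max'_le _ _ _ (by simp [h'.2])) (Finset.le_max' _ _ (by simp))

lemma sum_pairs (f : Fin 4 × Fin 4 → ℝ) :
    ∑ p ∈ pairs, f p = f (0, 1) + f (0, 2) + f (0, 3) + f (1, 2) + f (1, 3) + f (2, 3) := by
  have : pairs = {(0, 1), (0, 2), (0, 3), (1, 2), (1, 3), (2, 3)} := by decide
  rw [this]
  simp
  ring

/-- The covariance matrix of the three differences `X k - X i`, `i ≠ k`. -/
def diffCov (Λ : Mat) (k : Fin 4) : Matrix (Fin 3) (Fin 3) ℝ := Matrix.of fun i j ↦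
  Λ k k - Λ k (k.succAbove j) - Λ (k.succAbove i) k + Λ (k.succAbove i) (k.succAbove j)

/-- The coefficient matrix of the three differences `X k - X i`, `i ≠ k`. -/
def diffMatrix (k : Fin 4) : Matrix (Fin 3) (Fin 4) ℝ := Matrix.of fun i j ↦
    (Pi.single k 1 - Pi.single (k.succAbove i) 1 : Fin 4 → ℝ) j

/-- The congruence form transfers both semidefiniteness and definiteness from `Λ`. -/
lemma diffCov_eq (Λ : Mat) (k : Fin 4) :
    diffCov Λ k = diffMatrix k * Λ * (diffMatrix k)ᴴ := by
  ext i j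
  have h1 : ∀ m, (diffMatrix k * Λ) i m = Λ k m - Λ (k.succAbove i) m := by
    intro m
    simp [diffMatrix, mul_apply, sub_mul, Finset.sum_sub_distrib, Pi.single_apply]
  rw [mul_apply]
  simp only [h1]
  simp [diffMatrix, diffCov, mul_sub, Finset.sum_sub_distrib, Pi.single_apply]
  ring

lemma diffCov_posDef {Λ : Mat} (hΛ : Λ.PosDef) (k : Fin 4) : (diffCov Λ k).PosDef := by
  rw [diffCov_eq]
  refine hΛ.mul_mul_conjTranspose_same fun v w hvw ↦ ?_
  ext i
  -- The column `k.succAbove i` of `diffMatrix k` has the single nonzero entry `-1`, in row `i`, so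
  -- it isolates one coordinate of the vector.
  have := congrFun hvw (k.succAbove i)
  simpa [diffMatrix, vecMul, dotProduct, Pi.single_apply, Fin.succAbove_ne, mul_sub] using this

lemma edgeCov_eq_diffCov {Λ : Mat} (hΛ : Λ ∈ SBar) : edgeCov Λ = diffCov Λ 1 := by
  have hs := symm_of_mem hΛ
  ext i j
  fin_cases i <;> fin_cases j <;>
    simp [edgeCov, diffCov, Fin.succAbove, Fin.lt_def, hΛ.2, hs 1 0, hs 2 0, hs 3 0, hs 2 1,
      hs 3 1, hs 3 2] <;> ring

lemma edgeCov_det_nonneg {Λ : Mat} (hΛ : Λ ∈ SBar) : 0 ≤ (edgeCov Λ).det := by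
  rw [edgeCov_eq_diffCov hΛ, diffCov_eq]
  exact (hΛ.1.mul_mul_conjTranspose_same _).det_nonneg

lemma tildeA_sq {Λ : Mat} (hΛ : Λ ∈ SBar) : tildeA Λ ^ 2 = 2 * (edgeCov Λ).det := by
  unfold tildeA tetraVolume
  rw [mul_pow, mul_pow, div_pow, Real.sq_sqrt (edgeCov_det_nonneg hΛ), Real.sq_sqrt (by norm_num)]
  ring

/-- This is the identity `minor · minor - cofactor² = S m m · det S` for the Gram matrix of the
edges at one vertex, with `S m m = 2Λ'` and `Ã² = 2 det`; the determinant does not depend on the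
vertex. -/
lemma radicand_eq {Λ : Mat} (hΛ : Λ ∈ SBar) {k l a b : Fin 4}
    (h : IsEdge k l a b) :
    radicand Λ k l = heron Λ k l a * heron Λ k l b := by
  rw [radicand, tildeA_sq hΛ, tilde_eq Λ h]
  have hs := symm_of_mem hΛ
  have h1 := hs 1 0
  have h2 := hs 2 0
  have h3 := hs 3 0
  have h4 := hs 2 1
  have h5 := hs 3 1
  have h6 := hs 3 2
  cases h <;>
  · simp only [edgeCov, det_fin_three, heron, tildeAux, prime, of_apply, cons_val', cons_val_zero,
      cons_val_one, cons_val, h1, h2, h3, h4, h5, h6]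
    ring

lemma arccos_tilde_eq {Λ : Mat} (hΛ : Λ ∈ SBar) {k l a b : Fin 4}
    (h : IsEdge k l a b) :
    Real.arccos (tilde Λ k l / √(prime Λ k l * tildeA Λ ^ 2 + tilde Λ k l ^ 2)) =
      edgeAngle Λ k l a b := by
  rw [edgeAngle, ← radicand_eq hΛ h, tilde_eq Λ h, radicand, tilde_eq Λ h]

lemma edgeAngle_swap_edge {Λ : Mat} (hΛ : Λ ∈ SBar) (k l a b : Fin 4) :
    edgeAngle Λ k l a b = edgeAngle Λ l k a b := by
  unfold edgeAngle
  congr 2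
  · simp only [tildeAux, symm_of_mem hΛ l k]
    ring
  · congr 1
    simp only [heron, prime, symm_of_mem hΛ l k]
    ring

/-- `diffCov Λ k` takes edges at `X k`, while `tildeAux` takes them at `X l`. The numerators agree
because both depend only on the projections orthogonal to the edge from `X k` to `X l`. -/
lemma exteriorAngle_diffCov {Λ : Mat} (hΛ : Λ ∈ SBar) (k : Fin 4) (m : Fin 3) :
    exteriorAngle (diffCov Λ k) m = edgeAngle Λ k (k.succAbove m)
      (k.succAbove (m.succAbove 0)) (k.succAbove (m.succAbove 1)) := by
  simp only [exteriorAngle, edgeAngle, diffCov, of_apply, heron, tildeAux, prime]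
  set l := k.succAbove m
  set a := k.succAbove (m.succAbove 0)
  set b := k.succAbove (m.succAbove 1)
  simp only [hΛ.2, symm_of_mem hΛ l k, symm_of_mem hΛ a k, symm_of_mem hΛ b k]
  congr 2
  · ring
  · congr 1
    ring

/-! ### The maximum as a sum over octants. -/

/-- Without ties exactly one index is the largest. Measured from `x₀`, the index `0` contributes
nothing, so three terms remain. -/
lemma max_eq_add_ite {x₀ x₁ x₂ x₃ : ℝ} (h01 : x₀ ≠ x₁) (h02 : x₀ ≠ x₂) (h03 : x₀ ≠ x₃)
    (h12 : x₁ ≠ x₂) (h13 : x₁ ≠ x₃) (h23 : x₂ ≠ x₃) :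
    max (max x₀ x₁) (max x₂ x₃) = x₀ + ((if 0 < x₁ - x₀ ∧ 0 < x₁ - x₂ ∧ 0 < x₁ - x₃ then x₁ - x₀ else 0)
      + (if 0 < x₂ - x₀ ∧ 0 < x₂ - x₁ ∧ 0 < x₂ - x₃ then x₂ - x₀ else 0)
      + (if 0 < x₃ - x₀ ∧ 0 < x₃ - x₁ ∧ 0 < x₃ - x₂ then x₃ - x₀ else 0)) := by
  have : (x₁ < x₀ ∧ x₂ < x₀ ∧ x₃ < x₀) ∨ (x₀ < x₁ ∧ x₂ < x₁ ∧ x₃ < x₁) ∨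
      (x₀ < x₂ ∧ x₁ < x₂ ∧ x₃ < x₂) ∨ (x₀ < x₃ ∧ x₁ < x₃ ∧ x₂ < x₃) := by
    rcases lt_or_gt_of_ne h01 with h | h <;> rcases lt_or_gt_of_ne h23 with h' | h' <;> grind
  rcases this with ⟨h, h', h''⟩ | ⟨h, h', h''⟩ | ⟨h, h', h''⟩ | ⟨h, h', h''⟩
  · rw [if_neg (by grind), if_neg (by grind), if_neg (by grind), max_eq_left h.le,
      max_eq_left (max_le h'.le h''.le)]
    ring
  · rw [if_pos (by grind), if_neg (by grind), if_neg (by grind), max_eq_right h.le,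
      max_eq_left (max_le h'.le h''.le)]
    ring
  · rw [if_neg (by grind), if_pos (by grind), if_neg (by grind), max_eq_left h''.le,
      max_eq_right (max_le h.le h'.le)]
    ring
  · rw [if_neg (by grind), if_neg (by grind), if_pos (by grind), max_eq_right h''.le,
      max_eq_right (max_le h.le h'.le)]
    ring

section
variable {Ω : Type*} [MeasurableSpace Ω] {P : Measure Ω} {X : Fin 4 → Ω → ℝ}

/-- The three differences `X k - X i`, `i ≠ k`. -/
def diffs (X : Fin 4 → Ω → ℝ) (k : Fin 4) (i : Fin 3) (ω : Ω) : ℝ := X k ω - X (k.succAbove i) ω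

lemma hasGaussianLaw_diffs (hX : HasGaussianLaw (fun ω ↦ (X · ω)) P) (k : Fin 4) :
    HasGaussianLaw (fun ω ↦ (diffs X k · ω)) P :=
  hX.map_fun (ContinuousLinearMap.pi fun i ↦
    ContinuousLinearMap.proj (R := ℝ) (φ := fun _ : Fin 4 ↦ ℝ) k -
      ContinuousLinearMap.proj (R := ℝ) (φ := fun _ : Fin 4 ↦ ℝ) (k.succAbove i))

lemma integral_diffs (hX : IsStdGaussianVector P X) (k : Fin 4) (i : Fin 3) :
    ∫ ω, diffs X k i ω ∂P = 0 := by
  have h : ∀ i, Integrable (X i) P := fun i ↦ hX.gaussian.integrable.eval i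
  unfold diffs
  rw [integral_sub (h _) (h _), hX.centered, hX.centered, sub_zero]

lemma cov_diffs (hX : IsStdGaussianVector P X) {Λ : Mat} (hcov : covMatrix P X = Λ) (k : Fin 4)
    (i j : Fin 3) : cov[diffs X k i, diffs X k j; P] = diffCov Λ k i j := by
  have : IsProbabilityMeasure P := hX.gaussian.isProbabilityMeasure
  have hL2 : ∀ i, MemLp (X i) 2 P := fun i ↦ hX.gaussian.memLp_two.eval i
  have hij : ∀ i j, cov[X i, X j; P] = Λ i j := fun i j ↦ by rw [← hcov]; rfl
  change cov[X k - X _, X k - X _; P] = _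
  rw [covariance_sub_left (hL2 _) (hL2 _) ((hL2 _).sub (hL2 _)),
    covariance_sub_right (hL2 _) (hL2 _) (hL2 _), covariance_sub_right (hL2 _) (hL2 _) (hL2 _)]
  simp only [hij, diffCov, of_apply]
  ring

/-- A real Gaussian of positive variance has no atoms. -/
lemma ae_diffs_ne_zero (hX : IsStdGaussianVector P X) {Λ : Mat} (hΛ : Λ.PosDef)
    (hcov : covMatrix P X = Λ) (k : Fin 4) (i : Fin 3) : ∀ᵐ ω ∂P, diffs X k i ω ≠ 0 := by
  have hY := (hasGaussianLaw_diffs hX.gaussian k).eval i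
  have hlaw := hY.map_eq_gaussianReal
  have hv : Var[diffs X k i; P].toNNReal ≠ 0 := by
    rw [← covariance_self hY.aemeasurable, cov_diffs hX hcov]
    exact (Real.toNNReal_pos.2 (diffCov_posDef hΛ k).diag_pos).ne'
  have := nullSingletonClass_gaussianReal (μ := P[diffs X k i]) hv
  have h0 : P.map (diffs X k i) {0} = 0 := by rw [hlaw]; exact measure_singleton 0
  rw [Measure.map_apply_of_aemeasurable hY.aemeasurable (measurableSet_singleton 0)] at h0
  exact measure_eq_zero_iff_ae_notMem.1 h0

/-- For `k ≠ 0` the coordinate `0` of `diffs X k` is `X k - X 0`, and the octant is the event that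
`X k` is strictly the largest. -/
lemma expMax_eq_sum_octants (hX : IsStdGaussianVector P X) {Λ : Mat} (hΛ : Λ.PosDef)
    (hcov : covMatrix P X = Λ) :
    expMax P X = ∑ k : Fin 3, ∫ ω,
      {y : Fin 3 → ℝ | ∀ i, 0 < y i}.indicator (fun y ↦ y 0) (diffs X k.succ · ω) ∂P := by
  have hint : ∀ i, Integrable (X i) P := fun i ↦ hX.gaussian.integrable.eval i
  set O := {y : Fin 3 → ℝ | ∀ i, 0 < y i} with hO
  have hOm : MeasurableSet O := by
    have : O = ⋂ i, {y : Fin 3 → ℝ | 0 < y i} := by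
      ext; simp [hO]
    rw [this]
    exact MeasurableSet.iInter fun i ↦ measurableSet_lt measurable_const (measurable_pi_apply i)
  have hI : ∀ k : Fin 4, Integrable (fun ω ↦ O.indicator (fun y ↦ y 0) (diffs X k · ω)) P := by
    intro k
    have hY := hasGaussianLaw_diffs hX.gaussian k
    refine (hY.integrable.eval 0).mono ?_ (ae_of_all _ fun ω ↦ ?_)
    · exact (((measurable_pi_apply 0).indicator hOm).comp_aemeasurable
        hY.aemeasurable).aestronglyMeasurable
    · exact norm_indicator_le_norm_self (fun y : Fin 3 → ℝ ↦ y 0) _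
  have hne := fun k i ↦ ae_diffs_ne_zero hX hΛ hcov k i
  have hae : (fun ω ↦ max (max (X 0 ω) (X 1 ω)) (max (X 2 ω) (X 3 ω))) =ᵐ[P]
      fun ω ↦ X 0 ω + ∑ k : Fin 3, O.indicator (fun y ↦ y 0) (diffs X k.succ · ω) := by
    filter_upwards [hne 0 0, hne 0 1, hne 0 2, hne 1 1, hne 1 2, hne 2 2] with ω h1 h2 h3 h4 h5 h6
    have h := max_eq_add_ite (x₀ := X 0 ω) (x₁ := X 1 ω) (x₂ := X 2 ω) (x₃ := X 3 ω)
      (sub_ne_zero.1 h1) (sub_ne_zero.1 h2) (sub_ne_zero.1 h3) (sub_ne_zero.1 h4)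
      (sub_ne_zero.1 h5) (sub_ne_zero.1 h6)
    rw [h, Fin.sum_univ_three]
    simp only [indicator_apply, hO, mem_ofPred_eq, Fin.forall_fin_succ, IsEmpty.forall_iff, and_true]
    rfl
  rw [expMax, integral_congr_ae hae, integral_add (hint 0)
    (integrable_finsetSum _ fun k _ ↦ hI k.succ), hX.centered, zero_add,
    integral_finsetSum _ fun k _ ↦ hI k.succ]

end

/-! ### The formula for positive definite matrices. -/

/-- Merges the terms that the two endpoints of one edge contribute. -/
lemma div_sqrt_combine {x y p : ℝ} (t : ℝ) (hxy : x + y = 2 * p) :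
    x / √(2 * p) * t + y / √(2 * p) * t = √2 * (√p * t) := by
  rw [← add_mul, ← add_div, hxy, Real.div_sqrt, Real.sqrt_mul (by norm_num), mul_assoc]

/-- The formula for nondegenerate vectors. -/
lemma F_eq_of_posDef {Λ : Mat} (hΛ : Λ ∈ SBar) (hpos : Λ.PosDef) :
    F Λ = 1 / (2 * √(Real.pi ^ 3)) *
        ∑ p ∈ pairs, √(prime Λ p.1 p.2) *
          Real.arccos (tilde Λ p.1 p.2 / √(prime Λ p.1 p.2 * tildeA Λ ^ 2 + tilde Λ p.1 p.2 ^ 2)) := by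
  obtain ⟨hX, hcov⟩ := isStdGaussianVector_coord hΛ
  have hs := symm_of_mem hΛ
  have h1 : F Λ = (√(2 * Real.pi))⁻¹ ^ 3 * (√2 *
      (√(prime Λ 0 1) * edgeAngle Λ 0 1 2 3 + √(prime Λ 0 2) * edgeAngle Λ 0 2 1 3 +
      √(prime Λ 0 3) * edgeAngle Λ 0 3 1 2 + √(prime Λ 1 2) * edgeAngle Λ 1 2 0 3 +
      √(prime Λ 1 3) * edgeAngle Λ 1 3 0 2 + √(prime Λ 2 3) * edgeAngle Λ 2 3 0 1)) := by
    rw [F, expMax_eq_sum_octants hX hpos hcov]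
    have h2 : ∀ k : Fin 3, _ := fun k ↦ integral_octant_coord (diffCov_posDef hpos k.succ)
      (hasGaussianLaw_diffs hX.gaussian k.succ) (integral_diffs hX k.succ)
      (cov_diffs hX hcov k.succ)
    simp only [h2, ← Finset.mul_sum, exteriorAngle_diffCov hΛ]
    congr 1
    simp only [Fin.sum_univ_three]
    simp [Fin.succAbove, Fin.lt_def]
    have d : ∀ k i, diffCov Λ k i i = 2 * prime Λ k (k.succAbove i) := by
      intro k i
      simp only [diffCov, of_apply, hΛ.2, prime, hs (k.succAbove i) k]
      ring
    have d0 : ∀ k i, √(diffCov Λ k i i) = √2 * √(prime Λ k (k.succAbove i)) := fun k i ↦ by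
      rw [d, Real.sqrt_mul (by norm_num)]
    -- By bilinearity, `cov(X 1 - X 0, X 1 - X 2) + cov(X 2 - X 0, X 2 - X 1) = Var(X 1 - X 2)`.
    have c12 : diffCov Λ 1 0 1 + diffCov Λ 2 0 1 = 2 * prime Λ 1 2 := by
      simp [diffCov, Fin.succAbove, Fin.lt_def, hΛ.2, prime, hs 2 1]
      ring
    have c13 : diffCov Λ 1 0 2 + diffCov Λ 3 0 1 = 2 * prime Λ 1 3 := by
      simp [diffCov, Fin.succAbove, Fin.lt_def, hΛ.2, prime, hs 3 1]
      ring
    have c23 : diffCov Λ 2 0 2 + diffCov Λ 3 0 2 = 2 * prime Λ 2 3 := by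
      simp [diffCov, Fin.succAbove, Fin.lt_def, hΛ.2, prime, hs 3 2]
      ring
    have p : ∀ k l, prime Λ k l = prime Λ l k := fun k l ↦ by rw [prime, prime, hs]
    have f12 := div_sqrt_combine (edgeAngle Λ 1 2 0 3) c12
    have f13 := div_sqrt_combine (edgeAngle Λ 1 3 0 2) c13
    have f23 := div_sqrt_combine (edgeAngle Λ 2 3 0 1) c23
    have s11 : diffCov Λ 1 1 1 = 2 * prime Λ 1 2 := d 1 1
    have s12 : diffCov Λ 1 2 2 = 2 * prime Λ 1 3 := d 1 2
    have s21 : diffCov Λ 2 1 1 = 2 * prime Λ 1 2 := (d 2 1).trans (by rw [p]; rfl)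
    have s22 : diffCov Λ 2 2 2 = 2 * prime Λ 2 3 := d 2 2
    have s31 : diffCov Λ 3 1 1 = 2 * prime Λ 1 3 := (d 3 1).trans (by rw [p]; rfl)
    have s32 : diffCov Λ 3 2 2 = 2 * prime Λ 2 3 := (d 3 2).trans (by rw [p]; rfl)
    -- For the edges at `X 0` the coefficient is `S 0 0 / √(S 0 0) = √(S 0 0)`, with no second term
    -- to merge.
    have s10 : √(diffCov Λ 1 0 0) = √2 * √(prime Λ 0 1) := (d0 1 0).trans (by rw [p]; rfl)
    have s20 : √(diffCov Λ 2 0 0) = √2 * √(prime Λ 0 2) := (d0 2 0).trans (by rw [p]; rfl)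
    have s30 : √(diffCov Λ 3 0 0) = √2 * √(prime Λ 0 3) := (d0 3 0).trans (by rw [p]; rfl)
    have e := edgeAngle_swap_edge hΛ
    simp only [s10, s20, s30, s11, s12, s21, s22, s31, s32, e 1 0, e 2 0, e 3 0,
      e 2 1, e 3 1, e 3 2]
    linear_combination f12 + f13 + f23
  have hc : (√(2 * Real.pi))⁻¹ ^ 3 * √2 = 1 / (2 * √(Real.pi ^ 3)) := by
    have h2 : √(Real.pi ^ 3) = Real.pi * √Real.pi := by
      rw [pow_succ, Real.sqrt_mul (by positivity), Real.sqrt_sq Real.pi_pos.le]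
    have h3 : √Real.pi ^ 2 = Real.pi := Real.sq_sqrt Real.pi_pos.le
    have h4 : √2 ^ 2 = 2 := Real.sq_sqrt (by norm_num)
    have h5 : 0 < √Real.pi := Real.sqrt_pos.2 Real.pi_pos
    have h6 := Real.pi_pos
    rw [h2, Real.sqrt_mul (by norm_num)]
    field_simp
    rw [h4, h3]
  rw [h1, ← mul_assoc, hc, sum_pairs]
  simp only [arccos_tilde_eq hΛ .e01, arccos_tilde_eq hΛ .e02, arccos_tilde_eq hΛ .e03,
    arccos_tilde_eq hΛ .e12, arccos_tilde_eq hΛ .e13, arccos_tilde_eq hΛ .e23]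

/-! ### Positivity of the radicands. -/

/-- Both summands are nonnegative on `SBar`, and the second is positive as soon as the three
variables are pairwise distinct. Hence unit vectors that are distinct never form a flat triangle. -/
lemma heron_eq_det_add {Λ : Mat} (hΛ : Λ ∈ SBar) (i j k : Fin 4) :
    heron Λ i j k = (Λ.submatrix ![i, j, k] ![i, j, k]).det +
      2 * (prime Λ i j * prime Λ j k * prime Λ i k) := by
  simp only [det_fin_three, submatrix_apply, cons_val_zero, cons_val_one, cons_val, heron, prime,
    hΛ.2, symm_of_mem hΛ j i, symm_of_mem hΛ k i, symm_of_mem hΛ k j]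
  ring

lemma sq_le_one_of_mem {Λ : Mat} (hΛ : Λ ∈ SBar) (i j : Fin 4) : Λ i j ^ 2 ≤ 1 := by
  have h := (hΛ.1.submatrix ![i, j]).det_nonneg
  simp only [det_fin_two, submatrix_apply, cons_val_zero, cons_val_one, hΛ.2,
    symm_of_mem hΛ j i] at h
  nlinarith

lemma prime_nonneg {Λ : Mat} (hΛ : Λ ∈ SBar) (i j : Fin 4) : 0 ≤ prime Λ i j := by
  have := sq_le_one_of_mem hΛ i j
  unfold prime
  nlinarith

lemma heron_pos {Λ : Mat} (hΛ : Λ ∈ SBar) {i j k : Fin 4} (hij : prime Λ i j ≠ 0)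
    (hjk : prime Λ j k ≠ 0) (hik : prime Λ i k ≠ 0) : 0 < heron Λ i j k := by
  rw [heron_eq_det_add hΛ]
  have h1 := (prime_nonneg hΛ i j).lt_of_ne' hij
  have h2 := (prime_nonneg hΛ j k).lt_of_ne' hjk
  have h3 := (prime_nonneg hΛ i k).lt_of_ne' hik
  have := (hΛ.1.submatrix ![i, j, k]).det_nonneg
  positivity

/-- With `Λ' i j = 0` the polynomial is minus a square, while `heron_eq_det_add` makes it a
nonnegative determinant. -/
lemma heron_eq_zero {Λ : Mat} (hΛ : Λ ∈ SBar) {i j : Fin 4} (hij : Λ i j = 1) (k : Fin 4) :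
    heron Λ i j k = 0 := by
  have h1 : prime Λ i j = 0 := by rw [prime, hij, sub_self]
  have h2 := heron_eq_det_add hΛ i j k
  have h3 := (hΛ.1.submatrix ![i, j, k]).det_nonneg
  have h4 : heron Λ i j k = -(prime Λ j k - prime Λ i k) ^ 2 := by
    rw [heron, h1]
    ring
  rw [h1, zero_mul, zero_mul, mul_zero, add_zero] at h2
  nlinarith [sq_nonneg (prime Λ j k - prime Λ i k)]

lemma mem_S₁_iff_mem_S₂ {Λ : Mat} (hΛ : Λ ∈ SBar) : Λ ∈ S₁ ↔ Λ ∈ S₂ := by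
  refine and_congr_right fun _ ↦ ⟨fun h k l hkl h1 ↦ ?_, fun h k l hkl ↦ ?_⟩
  · obtain ⟨a, b, he⟩ := exists_isEdge hkl
    have := h k l hkl
    rw [radicand_eq hΛ he, heron_eq_zero hΛ h1, zero_mul] at this
    exact this.false
  · obtain ⟨a, b, he⟩ := exists_isEdge hkl
    have hp : ∀ i j : Fin 4, i ≠ j → prime Λ i j ≠ 0 := by
      intro i j hij h0
      have h1 : Λ i j = 1 := (sub_eq_zero.1 h0).symm
      rcases lt_or_gt_of_ne hij with hlt | hlt
      · exact h i j hlt h1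
      · exact h j i hlt (by rw [symm_of_mem hΛ, h1])
    rw [radicand_eq hΛ he]
    have hne : k ≠ l ∧ k ≠ a ∧ k ≠ b ∧ l ≠ a ∧ l ≠ b := by cases he <;> decide
    exact mul_pos (heron_pos hΛ (hp _ _ hne.1) (hp _ _ hne.2.2.2.1) (hp _ _ hne.2.1))
      (heron_pos hΛ (hp _ _ hne.1) (hp _ _ hne.2.2.2.2) (hp _ _ hne.2.2.1))

/-! ### Passage to singular matrices. -/

/-- The interpolation between `Λ` and the identity matrix. -/
def interp (Λ : Mat) (t : ℝ) : Mat := (1 - t) • Λ + t • 1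

lemma interp_mem {Λ : Mat} (hΛ : Λ ∈ SBar) {t : ℝ} (h0 : 0 ≤ t) (h1 : t ≤ 1) :
    interp Λ t ∈ SBar := by
  refine ⟨(hΛ.1.smul (sub_nonneg.2 h1)).add (PosSemidef.one.smul h0), fun i ↦ ?_⟩
  simp [interp, hΛ.2]

lemma interp_posDef {Λ : Mat} (hΛ : Λ ∈ SBar) {t : ℝ} (h0 : 0 < t) (h1 : t ≤ 1) :
    (interp Λ t).PosDef :=
  PosDef.posSemidef_add (hΛ.1.smul (sub_nonneg.2 h1)) (PosDef.one.smul h0)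

/-- A Gaussian vector with covariance matrix `interp Λ t`. -/
def interpVec (t : ℝ) (i : Fin 4) (p : EuclideanSpace ℝ (Fin 4) × EuclideanSpace ℝ (Fin 4)) : ℝ :=
  √(1 - t) * p.1 i + √t * p.2 i

lemma interpVec_law {Λ : Mat} (hΛ : Λ ∈ SBar) {t : ℝ} (h0 : 0 ≤ t) (h1 : t ≤ 1) :
    IsStdGaussianVector ((multivariateGaussian 0 Λ).prod (multivariateGaussian 0 1))
      (interpVec t) ∧
    covMatrix ((multivariateGaussian 0 Λ).prod (multivariateGaussian 0 1)) (interpVec t) =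
      interp Λ t := by
  set P := multivariateGaussian (0 : EuclideanSpace ℝ (Fin 4)) Λ with hP
  set Q := multivariateGaussian (0 : EuclideanSpace ℝ (Fin 4)) (1 : Mat) with hQ
  have hI : (1 : Mat) ∈ SBar := ⟨PosSemidef.one, fun i ↦ by simp⟩
  obtain ⟨hx, hxc⟩ := isStdGaussianVector_coord hΛ
  obtain ⟨hg, hgc⟩ := isStdGaussianVector_coord hI
  rw [← hP] at hx hxc
  rw [← hQ] at hg hgc
  have hmx : ∀ i, MemLp (fun p : EuclideanSpace ℝ (Fin 4) × EuclideanSpace ℝ (Fin 4) ↦ p.1 i) 2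
      (P.prod Q) := fun i ↦ (hx.gaussian.memLp_two.eval i).comp_fst Q
  have hmg : ∀ i, MemLp (fun p : EuclideanSpace ℝ (Fin 4) × EuclideanSpace ℝ (Fin 4) ↦ p.2 i) 2
      (P.prod Q) := fun i ↦ (hg.gaussian.memLp_two.eval i).comp_snd P
  have hcen : ∀ i, ∫ p, interpVec t i p ∂(P.prod Q) = 0 := by
    intro i
    unfold interpVec
    rw [integral_add (((hmx i).integrable one_le_two).const_mul _)
      (((hmg i).integrable one_le_two).const_mul _), integral_const_mul, integral_const_mul,
      integral_fun_fst (f := fun x : EuclideanSpace ℝ (Fin 4) ↦ x i),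
      integral_fun_snd (f := fun x : EuclideanSpace ℝ (Fin 4) ↦ x i), hx.centered, hg.centered]
    simp
  have hxx : ∀ i j, cov[fun p : EuclideanSpace ℝ (Fin 4) × EuclideanSpace ℝ (Fin 4) ↦ p.1 i,
      fun p ↦ p.1 j; P.prod Q] = Λ i j := by
    intro i j
    have h := covariance_map_fun (μ := P.prod Q) (Z := Prod.fst)
      (X := fun x : EuclideanSpace ℝ (Fin 4) ↦ x i) (Y := fun x ↦ x j)
      (by fun_prop) (by fun_prop) (by fun_prop)
    rw [← h, Measure.map_fst_prod, measure_univ, one_smul]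
    exact congrFun (congrFun hxc i) j
  have hgg : ∀ i j, cov[fun p : EuclideanSpace ℝ (Fin 4) × EuclideanSpace ℝ (Fin 4) ↦ p.2 i,
      fun p ↦ p.2 j; P.prod Q] = (1 : Mat) i j := by
    intro i j
    have h := covariance_map_fun (μ := P.prod Q) (Z := Prod.snd)
      (X := fun x : EuclideanSpace ℝ (Fin 4) ↦ x i) (Y := fun x ↦ x j)
      (by fun_prop) (by fun_prop) (by fun_prop)
    rw [← h, Measure.map_snd_prod, measure_univ, one_smul]
    exact congrFun (congrFun hgc i) j
  have hxg : ∀ i j, cov[fun p : EuclideanSpace ℝ (Fin 4) × EuclideanSpace ℝ (Fin 4) ↦ p.1 i,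
      fun p ↦ p.2 j; P.prod Q] = 0 := by
    intro i j
    refine IndepFun.covariance_eq_zero ?_ (hmx i) (hmg j)
    exact indepFun_prod (X := fun x : EuclideanSpace ℝ (Fin 4) ↦ x i)
      (Y := fun x : EuclideanSpace ℝ (Fin 4) ↦ x j) (by fun_prop) (by fun_prop)
  have hgx : ∀ i j, cov[fun p : EuclideanSpace ℝ (Fin 4) × EuclideanSpace ℝ (Fin 4) ↦ p.2 i,
      fun p ↦ p.1 j; P.prod Q] = 0 := fun i j ↦ by rw [covariance_comm, hxg]
  have hcov : ∀ i j, cov[interpVec t i, interpVec t j; P.prod Q] = interp Λ t i j := by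
    intro i j
    have hdef : ∀ i, interpVec t i =
        (√(1 - t) • fun p : EuclideanSpace ℝ (Fin 4) × EuclideanSpace ℝ (Fin 4) ↦ p.1 i) +
        √t • fun p : EuclideanSpace ℝ (Fin 4) × EuclideanSpace ℝ (Fin 4) ↦ p.2 i := fun i ↦ rfl
    have hx' := fun i ↦ (hmx i).const_smul (√(1 - t))
    have hg' := fun i ↦ (hmg i).const_smul (√t)
    rw [hdef, hdef, covariance_add_left (hx' i) (hg' i) ((hx' j).add (hg' j)),
      covariance_add_right (hx' i) (hx' j) (hg' j), covariance_add_right (hg' i) (hx' j) (hg' j)]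
    simp only [covariance_smul_left, covariance_smul_right, hxx, hgg, hxg, hgx, interp,
      Matrix.add_apply, Matrix.smul_apply, smul_eq_mul]
    have e1 := Real.mul_self_sqrt (sub_nonneg.2 h1)
    have e2 := Real.mul_self_sqrt h0
    linear_combination Λ i j * e1 + (1 : Mat) i j * e2
  have hmem : ∀ i, MemLp (interpVec t i) 2 (P.prod Q) := fun i ↦
    ((hmx i).const_mul _).add ((hmg i).const_mul _)
  refine ⟨⟨?_, hcen, fun i ↦ ?_⟩, ?_⟩
  · exact (IsGaussian.hasGaussianLaw_id (μ := P.prod Q)).map_fun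
      (ContinuousLinearMap.pi fun i ↦
        √(1 - t) • (EuclideanSpace.proj i).comp (ContinuousLinearMap.fst ℝ _ _) +
        √t • (EuclideanSpace.proj i).comp (ContinuousLinearMap.snd ℝ _ _))
  · have h := covariance_eq_sub (hmem i) (hmem i)
    rw [hcov, (interp_mem hΛ h0 h1).2, hcen, mul_zero, sub_zero] at h
    rw [h]
    congr with p
    simp [sq]
  · ext i j
    exact hcov i j

lemma abs_max_le_add (a b : ℝ) : |max a b| ≤ |a| + |b| :=
  abs_max_le_max_abs_abs.trans (max_le_add_of_nonneg (abs_nonneg a) (abs_nonneg b))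

lemma abs_interpVec_le {t : ℝ} (h0 : 0 ≤ t) (h1 : t ≤ 1) (i : Fin 4)
    (p : EuclideanSpace ℝ (Fin 4) × EuclideanSpace ℝ (Fin 4)) :
    |interpVec t i p| ≤ |p.1 i| + |p.2 i| := by
  have e1 : √(1 - t) ≤ 1 := Real.sqrt_le_one.2 (by linarith)
  have e2 : √t ≤ 1 := Real.sqrt_le_one.2 h1
  refine (abs_add_le _ _).trans ?_
  rw [abs_mul, abs_mul, abs_of_nonneg (Real.sqrt_nonneg _), abs_of_nonneg (Real.sqrt_nonneg _)]
  exact add_le_add (mul_le_of_le_one_left (abs_nonneg _) e1)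
    (mul_le_of_le_one_left (abs_nonneg _) e2)

/-- The vectors `interpVec t` live on one probability space and depend continuously on `t`, with a
bound uniform in `t ∈ [0, 1]`; dominated convergence applies. -/
lemma tendsto_F_interp {Λ : Mat} (hΛ : Λ ∈ SBar) :
    Tendsto (fun t ↦ F (interp Λ t)) (𝓝[>] 0) (𝓝 (F Λ)) := by
  set P := (multivariateGaussian (0 : EuclideanSpace ℝ (Fin 4)) Λ).prod
    (multivariateGaussian (0 : EuclideanSpace ℝ (Fin 4)) (1 : Mat)) with hP
  have hF : ∀ t, 0 ≤ t → t ≤ 1 → F (interp Λ t) = expMax P (interpVec t) := fun t h0 h1 ↦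
    (expMax_eq_F (interpVec_law hΛ h0 h1).1 (interp_mem hΛ h0 h1)
      (interpVec_law hΛ h0 h1).2).symm
  have h0 : F Λ = expMax P (interpVec 0) := by
    rw [← hF 0 le_rfl zero_le_one]
    simp [interp]
  have hev : ∀ᶠ t : ℝ in 𝓝[>] 0, 0 ≤ t ∧ t ≤ 1 := by
    filter_upwards [Ioc_mem_nhdsGT (zero_lt_one (α := ℝ))] with t ht using ⟨ht.1.le, ht.2⟩
  have hlim : Tendsto (fun t ↦ expMax P (interpVec t)) (𝓝[>] 0) (𝓝 (expMax P (interpVec 0))) := by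
    have hcont : ∀ i p, Continuous fun t ↦ interpVec t i p := fun i p ↦ by
      unfold interpVec
      fun_prop
    have hix : ∀ i, Integrable (fun p : EuclideanSpace ℝ (Fin 4) × EuclideanSpace ℝ (Fin 4) ↦
        |p.1 i|) P := fun i ↦
      (((isStdGaussianVector_coord hΛ).1.gaussian.integrable.eval i).comp_fst _).abs
    have hig : ∀ i, Integrable (fun p : EuclideanSpace ℝ (Fin 4) × EuclideanSpace ℝ (Fin 4) ↦
        |p.2 i|) P := fun i ↦ by
      have hI : (1 : Mat) ∈ SBar := ⟨PosSemidef.one, fun i ↦ by simp⟩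
      exact (((isStdGaussianVector_coord hI).1.gaussian.integrable.eval i).comp_snd _).abs
    refine tendsto_integral_filter_of_dominated_convergence
      (fun p ↦ ((|p.1 0| + |p.2 0|) + (|p.1 1| + |p.2 1|)) +
        ((|p.1 2| + |p.2 2|) + (|p.1 3| + |p.2 3|))) ?_ ?_ ?_ ?_
    · refine Eventually.of_forall fun t ↦ Continuous.aestronglyMeasurable ?_
      unfold interpVec
      fun_prop
    · filter_upwards [hev] with t ht
      refine ae_of_all _ fun p ↦ ?_
      have h := fun i ↦ abs_interpVec_le ht.1 ht.2 i p
      exact (abs_max_le_add _ _).trans (add_le_add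
        ((abs_max_le_add _ _).trans (add_le_add (h 0) (h 1)))
        ((abs_max_le_add _ _).trans (add_le_add (h 2) (h 3))))
    · exact (((hix 0).add (hig 0)).add ((hix 1).add (hig 1))).add
        (((hix 2).add (hig 2)).add ((hix 3).add (hig 3)))
    · refine ae_of_all _ fun p ↦ ?_
      exact ((((hcont 0 p).max (hcont 1 p)).max ((hcont 2 p).max (hcont 3 p))).tendsto 0).mono_left
        nhdsWithin_le_nhds
  rw [h0]
  refine hlim.congr' ?_
  filter_upwards [hev] with t ht using (hF t ht.1 ht.2).symm

/-- Both sides are limits along `interp Λ t` as `t → 0+`. Membership in `S₁` is what keeps the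
denominators nonzero in the limit. -/
lemma F_eq_of_mem_S₁ {Λ : Mat} (hΛ : Λ ∈ S₁) :
    F Λ = 1 / (2 * √(Real.pi ^ 3)) *
        ∑ p ∈ pairs, √(prime Λ p.1 p.2) *
          Real.arccos (tilde Λ p.1 p.2 / √(prime Λ p.1 p.2 * tildeA Λ ^ 2 + tilde Λ p.1 p.2 ^ 2)) := by
  have hi0 : interp Λ 0 = Λ := by simp [interp]
  have hc : Continuous (interp Λ) := by
    unfold interp
    fun_prop
  have hentry : ∀ i j, Continuous fun t ↦ interp Λ t i j := fun i j ↦ hc.matrix_elem i j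
  have hp : ∀ i j, Continuous fun t ↦ prime (interp Λ t) i j := fun i j ↦
    continuous_const.sub (hentry i j)
  have hA : Continuous fun t ↦ tildeA (interp Λ t) := by
    unfold tildeA tetraVolume
    refine continuous_const.mul ((Real.continuous_sqrt.comp (Continuous.matrix_det ?_)).div_const _)
    refine continuous_matrix fun i j ↦ ?_
    fin_cases i <;> fin_cases j <;> simp [edgeCov] <;> fun_prop
  have ht : ∀ i j, Continuous fun t ↦ tilde (interp Λ t) i j := fun i j ↦ by
    unfold tilde tildeAux
    fun_prop
  refine tendsto_nhds_unique (tendsto_F_interp hΛ.1) ?_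
  have hev : ∀ᶠ t : ℝ in 𝓝[>] 0, 0 < t ∧ t ≤ 1 := Ioc_mem_nhdsGT (zero_lt_one (α := ℝ))
  refine Tendsto.congr' (f₁ := fun t ↦ 1 / (2 * √(Real.pi ^ 3)) *
        ∑ p ∈ pairs, √(prime (interp Λ t) p.1 p.2) *
          Real.arccos (tilde (interp Λ t) p.1 p.2 / √(prime (interp Λ t) p.1 p.2 *
            tildeA (interp Λ t) ^ 2 + tilde (interp Λ t) p.1 p.2 ^ 2))) ?_ ?_
  · filter_upwards [hev] with t ht
    exact (F_eq_of_posDef (interp_mem hΛ.1 ht.1.le ht.2) (interp_posDef hΛ.1 ht.1 ht.2)).symm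
  · refine Tendsto.const_mul _ (tendsto_finsetSum _ fun p hp' ↦ ?_)
    have hlt : p.1 < p.2 := by simpa [pairs] using hp'
    have hne : √(prime (interp Λ 0) p.1 p.2 * tildeA (interp Λ 0) ^ 2 +
        tilde (interp Λ 0) p.1 p.2 ^ 2) ≠ 0 := by
      rw [hi0]
      exact (Real.sqrt_pos.2 (hΛ.2 _ _ hlt)).ne'
    have hcat : ContinuousAt (fun t ↦ √(prime (interp Λ t) p.1 p.2) *
          Real.arccos (tilde (interp Λ t) p.1 p.2 / √(prime (interp Λ t) p.1 p.2 *
            tildeA (interp Λ t) ^ 2 + tilde (interp Λ t) p.1 p.2 ^ 2))) 0 := by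
      refine (hp _ _).sqrt.continuousAt.mul (Real.continuous_arccos.continuousAt.comp ?_)
      exact (ht _ _).continuousAt.div
        (((hp _ _).mul (hA.pow 2)).add ((ht _ _).pow 2)).sqrt.continuousAt hne
    have := hcat.tendsto
    rw [hi0] at this
    exact this.mono_left nhdsWithin_le_nhds

/-! ### Two coinciding variables. -/

lemma integral_abs_gaussianReal (v : NNReal) :
    ∫ x, |x| ∂(gaussianReal 0 v) = √(2 * v / Real.pi) := by
  rcases eq_or_ne v 0 with rfl | hv
  · simp
  have hv' : (0 : ℝ) < v := by positivity
  rw [integral_gaussianReal_eq_integral_smul hv]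
  have h1 : ∀ x : ℝ, gaussianPDFReal 0 v x • |x| =
      (fun y : ℝ ↦ (√(2 * Real.pi * v))⁻¹ * (y * Real.exp (-((1 / v) * y ^ 2) / 2))) |x| := by
    intro x
    simp only [gaussianPDFReal, sub_zero, smul_eq_mul, sq_abs]
    have : -x ^ 2 / (2 * (v : ℝ)) = -((1 / v) * x ^ 2) / 2 := by field_simp
    rw [this]
    ring
  simp_rw [h1]
  rw [integral_comp_abs (f := fun y : ℝ ↦
    (√(2 * Real.pi * v))⁻¹ * (y * Real.exp (-((1 / v) * y ^ 2) / 2))), integral_const_mul,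
    (integral_Ioi_mul_exp_neg_sq (by positivity)).2, one_div_one_div]
  have hpi := Real.pi_pos
  rw [eq_comm, Real.sqrt_eq_iff_mul_self_eq (by positivity) (by positivity)]
  have : √(2 * v * Real.pi) ^ 2 = 2 * v * Real.pi := Real.sq_sqrt (by positivity)
  rw [show 2 * Real.pi * (v : ℝ) = 2 * v * Real.pi by ring]
  field_simp
  rw [this]

section
variable {Ω : Type*} [MeasurableSpace Ω] {P : Measure Ω} {X : Fin 4 → Ω → ℝ}

lemma variance_sub_eq {Λ : Mat} (hΛ : Λ ∈ SBar) (hX : IsStdGaussianVector P X)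
    (hcov : covMatrix P X = Λ) (i j : Fin 4) :
    Var[X i - X j; P] = 2 * prime Λ i j := by
  have : IsProbabilityMeasure P := hX.gaussian.isProbabilityMeasure
  have hL2 : ∀ i, MemLp (X i) 2 P := fun i ↦ hX.gaussian.memLp_two.eval i
  have hij : ∀ i j, cov[X i, X j; P] = Λ i j := fun i j ↦ by rw [← hcov]; rfl
  rw [variance_sub (hL2 i) (hL2 j), ← covariance_self (hL2 i).aemeasurable,
    ← covariance_self (hL2 j).aemeasurable, hij, hij, hij, hΛ.2, hΛ.2, prime]
  ring

lemma integral_abs_sub {Λ : Mat} (hΛ : Λ ∈ SBar) (hX : IsStdGaussianVector P X)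
    (hcov : covMatrix P X = Λ) (i j : Fin 4) :
    ∫ ω, |X i ω - X j ω| ∂P = 2 / √Real.pi * √(prime Λ i j) := by
  have hint : ∀ i, Integrable (X i) P := fun i ↦ hX.gaussian.integrable.eval i
  have hG : HasGaussianLaw (X i - X j) P := (hX.gaussian.prodMk i j).sub
  have hmean : P[X i - X j] = 0 := by
    rw [integral_sub' (hint i) (hint j), hX.centered, hX.centered, sub_zero]
  have hlaw := hG.map_eq_gaussianReal
  rw [hmean, variance_sub_eq hΛ hX hcov] at hlaw
  have h := integral_map (f := fun x : ℝ ↦ |x|) hG.aemeasurable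
    (continuous_abs.aestronglyMeasurable)
  rw [hlaw, integral_abs_gaussianReal] at h
  have hp := prime_nonneg hΛ i j
  rw [Real.coe_toNNReal _ (by positivity), ← mul_assoc, Real.sqrt_div' _ Real.pi_pos.le,
    Real.sqrt_mul' _ hp] at h
  have h4 : √(2 * 2 : ℝ) = 2 := Real.sqrt_mul_self (by norm_num)
  rw [h4] at h
  simp only [Pi.sub_apply] at h
  rw [← h]
  ring

lemma ae_eq_of_entry_eq_one {Λ : Mat} (hΛ : Λ ∈ SBar) (hX : IsStdGaussianVector P X)
    (hcov : covMatrix P X = Λ) {i j : Fin 4} (hij : Λ i j = 1) : ∀ᵐ ω ∂P, X i ω = X j ω := by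
  have hint : ∀ i, Integrable (X i) P := fun i ↦ hX.gaussian.integrable.eval i
  have h := integral_abs_sub hΛ hX hcov i j
  rw [prime, hij, sub_self, Real.sqrt_zero, mul_zero,
    integral_eq_zero_iff_of_nonneg (f := fun ω ↦ |X i ω - X j ω|) (fun ω ↦ abs_nonneg _)
      ((hint i).sub (hint j)).abs] at h
  filter_upwards [h] with ω hω
  exact sub_eq_zero.1 (abs_eq_zero.1 hω)

lemma isStdGaussianVector_neg (hX : IsStdGaussianVector P X) :
    IsStdGaussianVector P (fun i ω ↦ -X i ω) ∧
      covMatrix P (fun i ω ↦ -X i ω) = covMatrix P X := by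
  refine ⟨⟨hX.gaussian.fun_neg, fun i ↦ ?_, fun i ↦ ?_⟩, ?_⟩
  · rw [integral_neg, hX.centered, neg_zero]
  · simpa using hX.second_moment i
  · ext i j
    simp [covMatrix]

end

/-- The left side is the largest minus the smallest of the three numbers; the largest distance
equals the sum of the other two. -/
lemma max_add_max_neg (a b c : ℝ) :
    max (max a b) (max c a) + max (max (-a) (-b)) (max (-c) (-a)) =
      (|a - b| + |a - c| + |b - c|) / 2 := by
  simp only [max_def, abs_eq_max_neg]
  grind

/-- The formula when two of the variables coincide. -/
lemma F_eq_of_entry_eq_one {Λ : Mat} (hΛ : Λ ∈ SBar) (h : Λ 0 3 = 1) :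
    F Λ = 1 / (2 * √Real.pi) * (√(prime Λ 0 1) + √(prime Λ 0 2) + √(prime Λ 1 2)) := by
  obtain ⟨hX, hcov⟩ := isStdGaussianVector_coord hΛ
  set P := multivariateGaussian (0 : EuclideanSpace ℝ (Fin 4)) Λ
  obtain ⟨hn, hncov⟩ := isStdGaussianVector_neg hX
  have hint : ∀ i : Fin 4, Integrable (fun x : EuclideanSpace ℝ (Fin 4) ↦ x i) P := fun i ↦
    hX.gaussian.integrable.eval i
  have habs : ∀ i j : Fin 4, Integrable (fun x : EuclideanSpace ℝ (Fin 4) ↦ |x i - x j|) P :=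
    fun i j ↦ ((hint i).sub (hint j)).abs
  have h1 := expMax_eq_F hn hΛ (hncov.trans hcov)
  -- One copy of `F Λ` is computed with `X` and the other with `-X`, which has the same covariance
  -- matrix.
  have h2 : F Λ + F Λ = ∫ x : EuclideanSpace ℝ (Fin 4),
      (|x 0 - x 1| + |x 0 - x 2| + |x 1 - x 2|) / 2 ∂P := by
    nth_rewrite 2 [← h1]
    rw [F, expMax, expMax, ← integral_add (integrable_max hX.gaussian)
      (integrable_max hn.gaussian)]
    refine integral_congr_ae ?_
    filter_upwards [ae_eq_of_entry_eq_one hΛ hX hcov h] with x hx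
    rw [← hx, max_add_max_neg]
  rw [integral_div, integral_add (f := fun x : EuclideanSpace ℝ (Fin 4) ↦
      |x 0 - x 1| + |x 0 - x 2|) ((habs 0 1).add (habs 0 2)) (habs 1 2),
    integral_add (habs 0 1) (habs 0 2), integral_abs_sub hΛ hX hcov, integral_abs_sub hΛ hX hcov,
    integral_abs_sub hΛ hX hcov] at h2
  have : 0 < √Real.pi := Real.sqrt_pos.2 Real.pi_pos
  field_simp at h2 ⊢
  linarith

end GaussMax

end

theorem mainTheorem4 (Λ : GaussMax.Mat) (hΛ : Λ ∈ GaussMax.SBar) :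
    (Λ ∈ GaussMax.S₁ ↔ Λ ∈ GaussMax.S₂) ∧
    (Λ ∈ GaussMax.S₁ →
      GaussMax.F Λ = 1 / (2 * Real.sqrt (Real.pi ^ 3)) *
        ∑ p ∈ GaussMax.pairs, Real.sqrt (GaussMax.prime Λ p.1 p.2) *
          Real.arccos (GaussMax.tilde Λ p.1 p.2 / Real.sqrt
            (GaussMax.prime Λ p.1 p.2 * GaussMax.tildeA Λ ^ 2 + GaussMax.tilde Λ p.1 p.2 ^ 2))) ∧
    (Λ 0 3 = 1 →
      GaussMax.F Λ = 1 / (2 * Real.sqrt Real.pi) *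
        (Real.sqrt (GaussMax.prime Λ 0 1) + Real.sqrt (GaussMax.prime Λ 0 2)
          + Real.sqrt (GaussMax.prime Λ 1 2))) :=
  ⟨GaussMax.mem_S₁_iff_mem_S₂ hΛ, GaussMax.F_eq_of_mem_S₁, GaussMax.F_eq_of_entry_eq_one hΛ⟩
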